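/- Let $V$ be a finite-dimensional real vector space with complexification $E=V\oplus iV$. Let $F,F'\subset V$ be (locally closed) real-analytic submanifolds that are conical, i.e. $x\in T_xF$ for all $x\in F$ and $x\in T_xF'$ for all $x\in F'$, and let $M=F\oplus iV$, $M'=F'\oplus iV$ be the tubes over them in $E$. Put $H_zM=T_zM\cap iT_zM$; a map between $M$ and $M'$ is CR if its differential maps each $H_zM$ complex linearly into the corresponding holomorphic tangent space of $M'$. Let $a\in F$ and suppose that the real Lie algebra $\mathfrak{hol}(M,a)$ of germs at $a$ of real-analytic infinitesimal CR-transformations of $M$ (real-analytic vector fields tangent to $M$ whose local flow consists of CR-maps) has finite dimension. Then, for every $a'\in F'$, every CR-isomorphism of manifold germs $h:(M,a)\to(M',a')$ (a germ of a real-analytic diffeomorphism between neighbourhoods of $a$ in $M$ and of $a'$ in $M'$, with $h(a)=a'$ and both $h$ and $h^{-1}$ CR) is rational: there are polynomial maps $P:E\to E$ and $Q:E\to\mathbb C$ with $Q(a)\neq0$ such that $h(z)=P(z)/Q(z)$ for all $z\in M$ near $a$. -/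

import Mathlib

open Set Filter Topology

namespace CRTube

section Real

variable {X : Type*} [NormedAddCommGroup X] [NormedSpace ℝ X]

/-- `S` is a (locally closed, embedded) real-analytic submanifold of the real vector space `X`:
around each of its points there is a real-analytic coordinate change of `X` that
straightens `S` to a linear subspace. -/
def IsAnalyticSubmanifold (S : Set X) : Prop :=
  ∀ x ∈ S, ∃ (Y : Submodule ℝ X) (e : OpenPartialHomeomorph X X),
    x ∈ e.source ∧ AnalyticOnNhd ℝ e e.source ∧ AnalyticOnNhd ℝ e.symm e.target ∧
      ∀ y ∈ e.source, (y ∈ S ↔ e y ∈ Y)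

/-- The tangent space `T_x S`: all velocity vectors at `x` of curves in `S` through `x`. -/
def tangentVectors (S : Set X) (x : X) : Set X :=
  {v | ∃ γ : ℝ → X, γ 0 = x ∧ (∀ᶠ t in 𝓝 (0 : ℝ), γ t ∈ S) ∧ HasDerivAt γ v 0}

/-- `S` is conical: `x ∈ T_x S` for every `x ∈ S`. -/
def IsConical (S : Set X) : Prop :=
  ∀ x ∈ S, x ∈ tangentVectors S x

end Real

section Complex

variable {E : Type*} [NormedAddCommGroup E] [NormedSpace ℂ E]

/-- `E = V ⊕ iV`, that is, `E` is the complexification of its real subspace `V`. -/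
def IsRealForm (V : Submodule ℝ E) : Prop :=
  ∀ z : E, ∃! p : V × V, z = (p.1 : E) + Complex.I • (p.2 : E)

/-- The tube `M = F ⊕ iV` over `F ⊆ V`. -/
def tube (V : Submodule ℝ E) (F : Set V) : Set E :=
  {z | ∃ x ∈ F, ∃ v : V, z = (x : E) + Complex.I • (v : E)}

/-- The holomorphic tangent space `H_z M = T_z M ∩ i T_z M`. -/
def holTangent (M : Set E) (z : E) : Set E :=
  {v | v ∈ tangentVectors M z ∧ Complex.I • v ∈ tangentVectors M z}

/-- `h : M → M'` is CR at `z ∈ M`: its differential at `z` maps `H_z M` to `H_{h(z)} M'` in a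
complex linear way. (Only the restriction of `L` to `T_z M` matters, and this restriction is
the differential of `h` at `z`, hence uniquely determined by the values of `h` on `M`.) -/
def IsCRAt (M M' : Set E) (h : E → E) (z : E) : Prop :=
  ∃ L : E →L[ℝ] E, HasFDerivWithinAt h L M z ∧
    ∀ v ∈ holTangent M z, L v ∈ holTangent M' (h z) ∧ L (Complex.I • v) = Complex.I • L v

/-- `h` represents a CR-isomorphism `(M, a) → (M', a')` of manifold germs: it restricts to a
real-analytic CR-diffeomorphism (with real-analytic CR inverse `k`) between open
neighbourhoods `M ∩ U` of `a` in `M` and `M' ∩ U'` of `a'` in `M'`, and it maps `a` to `a'`.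
Only the values of `h` on `M` near `a` matter. -/
def IsCRIsoGerm (M : Set E) (a : E) (M' : Set E) (a' : E) (h : E → E) : Prop :=
  h a = a' ∧ ∃ (U U' : Set E) (k : E → E), IsOpen U ∧ IsOpen U' ∧ a ∈ U ∧ a' ∈ U' ∧
    MapsTo h (M ∩ U) (M' ∩ U') ∧ MapsTo k (M' ∩ U') (M ∩ U) ∧
    InvOn k h (M ∩ U) (M' ∩ U') ∧
    AnalyticOn ℝ h (M ∩ U) ∧ AnalyticOn ℝ k (M' ∩ U') ∧
    (∀ z ∈ M ∩ U, IsCRAt M M' h z) ∧ (∀ w ∈ M' ∩ U', IsCRAt M' M k w)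

/-- `Φ : (-ε, ε) × (M ∩ W) → M ∩ U` is a real-analytic local flow of the vector field `f`
on the open piece `M ∩ U` of `M`. -/
def IsLocalFlow (M U : Set E) (f : E → E) (W : Set E) (ε : ℝ) (Φ : ℝ → E → E) : Prop :=
  AnalyticOn ℝ (fun p : ℝ × E => Φ p.1 p.2) (Ioo (-ε) ε ×ˢ (M ∩ W)) ∧
    ∀ z ∈ M ∩ W, Φ 0 z = z ∧
      ∀ t ∈ Ioo (-ε) ε, Φ t z ∈ M ∩ U ∧ HasDerivAt (fun s => Φ s z) (f (Φ t z)) t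

/-- `f` is an infinitesimal CR-transformation on the open piece `M ∩ U` of `M`: a real-analytic
vector field, tangent to `M`, whose local flow consists of CR-transformations. (A real-analytic
tangent field has a local flow around every point of `M ∩ U`, and local flows are
unique, so that the last condition does constrain `f`.) -/
def IsInfinitesimalCR (M U : Set E) (f : E → E) : Prop :=
  AnalyticOn ℝ f (M ∩ U) ∧ (∀ z ∈ M ∩ U, f z ∈ tangentVectors M z) ∧
    ∀ (W : Set E) (ε : ℝ) (Φ : ℝ → E → E), IsOpen W → 0 < ε → IsLocalFlow M U f W ε Φ →
      ∀ t ∈ Ioo (-ε) ε, ∀ z ∈ M ∩ W, IsCRAt M M (Φ t) z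

/-- `hol(M, a)`: all germs at `a ∈ M` of infinitesimal CR-transformations defined on
arbitrary open neighbourhoods of `a` in `M`. -/
def hol (M : Set E) (a : E) : Set (Germ (𝓝[M] a) E) :=
  {ξ | ∃ (U : Set E) (f : E → E), IsOpen U ∧ a ∈ U ∧ IsInfinitesimalCR M U f ∧
    ξ = (f : Germ (𝓝[M] a) E)}

/-- `hol(M, a)` has finite dimension. For a generic real-analytic CR-submanifold the set
`hol M a` is already a real vector space, so that it coincides with its linear span. -/
def HolFiniteDimensional (M : Set E) (a : E) : Prop :=
  FiniteDimensional ℝ (Submodule.span ℝ (hol M a))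

/-- `P : E → G` is a (complex) polynomial map: a finite sum of homogeneous polynomials
`z ↦ p_k(z, …, z)` with `p_k` a `k`-linear map. -/
def IsPolynomialMap {G : Type*} [NormedAddCommGroup G] [NormedSpace ℂ G] (P : E → G) : Prop :=
  ∃ (p : FormalMultilinearSeries ℂ E G) (N : ℕ), ∀ z, P z = p.partialSum N z

/-- The germ at `a` of the map `h` on `M` is rational: near `a` it is the restriction to `M` of
a rational map `P / Q` that is regular at `a`. -/
def IsRationalGerm (M : Set E) (a : E) (h : E → E) : Prop :=
  ∃ (P : E → E) (Q : E → ℂ), IsPolynomialMap P ∧ IsPolynomialMap Q ∧ Q a ≠ 0 ∧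
    ∀ᶠ z in 𝓝[M] a, h z = (Q z)⁻¹ • P z

end Complex

end CRTube

/-!
The idea: a CR-isomorphism `h : (M, a) → (M', a')` transports infinitesimal CR-transformations of
`M'` to infinitesimal CR-transformations of `M`, and finite dimensionality together with conicality
forces all of the latter to be polynomial. On `M'` there are the translation fields `i v`, `v ∈ V`,
and, since `F'` is conical, the Euler field `w ↦ w`. With `k = h⁻¹` and `C(z) = k'(h(z))`, complex
linear, their pullbacks are `z ↦ C(z)(i v)` and `z ↦ C(z)(h(z))`. Hence all entries of the matrix of
`C(z)`, and the vector `C(z) h(z)`, are polynomial in `z`, and `C(a)` is invertible; Cramer's rule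
gives `h` as a quotient with denominator `det C(z)` (`isRationalGerm_of_cpolynomialOn`).

Calculus on `M`. The tube `M = F ⊕ iV` is generic: its tangent spaces contain `iV`, so they span
`E` over `ℂ`, and `M` has unique differentials over `ℂ` (`uniqueDiffWithinAt_tube`). A real
derivative within `M` may be altered off the tangent space
(`hasFDerivWithinAt_of_eq_on_tangentVectors`), so a map `M → E` is CR exactly when it is complex
differentiable *within* `M`. Therefore no holomorphic extension off `M` is ever needed:
`fderivWithin ℂ f M z` plays the role of the holomorphic derivative. For real-analytic `f` its
directional derivatives are CR again and commute (`IsCRFunctionAt.fderivWithin_apply`); symmetry of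
the second derivative of a local real-analytic extension of `f` is what is used.

Polynomiality of fields (`exists_cpolynomialOn_eventually_eq`). A real-analytic tangent field which
is a CR function lies in `hol(M, a)`: along a flow line the derivative of the flow solves a
complex linear ODE, so it is complex linear on `H_z M` if it is so at time `0`
(`isInfinitesimalCR_of_isCRFunctionAt`). The complex span `W` of the germs of such fields is thus
finite dimensional. Brackets with `i v` and with the Euler field show that `W` is stable under the
directional derivatives `∂_u` and under the derivative `δ` along the Euler field. Since
`[∂_u, δ] = ∂_u`, every `∂_u` is nilpotent on `W` (`isNilpotent_of_commutator_eq_self`). Evaluation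
at `z` of an element of `W` equals evaluation at `a` after applying `exp (∂_{z - a})`
(`eventually_eq_exp_apply`), and this exponential is a polynomial in `z`.
-/

namespace CRTube

/-! ### Tangent vectors of analytic submanifolds -/

section Submanifolds

theorem exists_comp_eq_of_ker_le {K A B C : Type*} [Field K] [AddCommGroup A] [Module K A]
    [AddCommGroup B] [Module K B] [AddCommGroup C] [Module K C] {f : A →ₗ[K] B} {g : A →ₗ[K] C}
    (h : LinearMap.ker f ≤ LinearMap.ker g) : ∃ r : B →ₗ[K] C, r ∘ₗ f = g := by
  obtain ⟨r, hr⟩ := LinearMap.exists_extend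
    ((LinearMap.ker f).liftQ g h ∘ₗ f.quotKerEquivRange.symm.toLinearMap)
  refine ⟨r, LinearMap.ext fun a => ?_⟩
  have := LinearMap.congr_fun hr ⟨f a, LinearMap.mem_range_self f a⟩
  simpa using this

variable {X : Type*} [NormedAddCommGroup X] [NormedSpace ℝ X] [FiniteDimensional ℝ X]

theorem exists_clm_ker_eq (Y : Submodule ℝ X) : ∃ q : X →L[ℝ] X, ∀ x, q x = 0 ↔ x ∈ Y := by
  obtain ⟨Z, hZ⟩ := Y.exists_isCompl
  refine ⟨(Z.subtype ∘ₗ Z.projectionOnto Y hZ.symm).toContinuousLinearMap, fun x => ?_⟩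
  simp

omit [FiniteDimensional ℝ X] in
/-- In a straightening chart `e`, the tangent vectors are those which the derivative of `e` maps to
the straightened subspace `Y`, here given as the zero set of `q`. -/
theorem mem_tangentVectors_iff {S : Set X} {Y : Submodule ℝ X} {e : OpenPartialHomeomorph X X}
    (he : AnalyticOnNhd ℝ e e.source) (he' : AnalyticOnNhd ℝ e.symm e.target)
    (hS : ∀ y ∈ e.source, (y ∈ S ↔ e y ∈ Y)) {q : X →L[ℝ] X} (hq : ∀ x, q x = 0 ↔ x ∈ Y)
    {x : X} (hx : x ∈ S) (hxe : x ∈ e.source) (u : X) :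
    u ∈ tangentVectors S x ↔ q (fderiv ℝ e x u) = 0 := by
  have hde : HasFDerivAt e (fderiv ℝ e x) x := (he x hxe).differentiableAt.hasFDerivAt
  constructor
  · rintro ⟨γ, h0, hγ, hd⟩
    have h1 : HasDerivAt (fun t => q (e (γ t))) (q (fderiv ℝ e x u)) 0 := by
      subst h0
      exact (q.hasFDerivAt.comp_hasDerivAt _ (hde.comp_hasDerivAt (0 : ℝ) hd))
    have h2 : (fun t => q (e (γ t))) =ᶠ[𝓝 0] fun _ => 0 := by
      have : ∀ᶠ t in 𝓝 (0 : ℝ), γ t ∈ e.source :=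
        hd.continuousAt.eventually (by rw [h0]; exact e.open_source.mem_nhds hxe)
      filter_upwards [hγ, this] with t ht1 ht2
      exact (hq _).2 ((hS _ ht2).1 ht1)
    exact (h1.congr_of_eventuallyEq h2.symm).unique (hasDerivAt_const _ _)
  · intro hu
    rw [hq] at hu
    set y := e x with hy
    have hyt : y ∈ e.target := e.map_source hxe
    have hde' : HasFDerivAt e.symm (fderiv ℝ e.symm y) y :=
      (he' y hyt).differentiableAt.hasFDerivAt
    have hinv : fderiv ℝ e.symm y (fderiv ℝ e x u) = u := by
      have h1 : HasFDerivAt (fun z => e.symm (e z)) ((fderiv ℝ e.symm y).comp (fderiv ℝ e x)) x :=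
        HasFDerivAt.comp x hde' hde
      have h2 : (fun z => e.symm (e z)) =ᶠ[𝓝 x] id := e.eventually_left_inverse hxe
      have h3 := (h1.congr_of_eventuallyEq h2.symm).unique (hasFDerivAt_id x)
      exact congrArg (fun L : X →L[ℝ] X => L u) h3
    have hline : HasDerivAt (fun t : ℝ => y + t • fderiv ℝ e x u) (fderiv ℝ e x u) 0 := by
      simpa using ((hasDerivAt_id (0 : ℝ)).smul_const (fderiv ℝ e x u)).const_add y
    refine ⟨fun t => e.symm (y + t • fderiv ℝ e x u), by simp [hy, hxe], ?_, ?_⟩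
    · have : ∀ᶠ t in 𝓝 (0 : ℝ), y + t • fderiv ℝ e x u ∈ e.target :=
        hline.continuousAt.eventually (by simpa using e.open_target.mem_nhds hyt)
      filter_upwards [this] with t ht
      rw [hS _ (e.map_target ht), e.right_inv ht]
      exact Y.add_mem ((hS _ hxe).1 hx) (Y.smul_mem _ hu)
    · have := HasFDerivAt.comp_hasDerivAt_of_eq (x := (0 : ℝ)) (y := y) (l := e.symm) hde' hline (by simp)
      rwa [hinv] at this

end Submanifolds

/-! ### Real forms and the geometry of tubes -/

section RealForm

variable {E : Type*} [NormedAddCommGroup E] [NormedSpace ℂ E] {V : Submodule ℝ E}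

theorem IsRealForm.ext (hV : IsRealForm V) {x y x' y' : V}
    (h : (x : E) + Complex.I • (y : E) = x' + Complex.I • (y' : E)) : x = x' ∧ y = y' := by
  have := (hV ((x : E) + Complex.I • (y : E))).unique (y₁ := (x, y)) (y₂ := (x', y')) rfl h
  simpa using this

/-- The real part with respect to the real form `V`, as a linear map. -/
noncomputable def IsRealForm.reₗ (hV : IsRealForm V) : E →ₗ[ℝ] V where
  toFun z := (hV z).choose.1
  map_add' z w := by
    refine (hV.ext (y := (hV (z + w)).choose.2)
      (y' := (hV z).choose.2 + (hV w).choose.2) ?_).1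
    rw [← (hV (z + w)).choose_spec.1]
    conv_lhs => rw [(hV z).choose_spec.1, (hV w).choose_spec.1]
    push_cast
    rw [smul_add]
    abel
  map_smul' r z := by
    refine (hV.ext (y := (hV (r • z)).choose.2) (y' := r • (hV z).choose.2) ?_).1
    rw [← (hV (r • z)).choose_spec.1]
    conv_lhs => rw [(hV z).choose_spec.1]
    simp only [RingHom.id_apply, Submodule.coe_smul, smul_add]
    rw [smul_comm]

variable [FiniteDimensional ℂ E]

/-- The real part `E → V` with respect to the real form `V`. -/
noncomputable def IsRealForm.re (hV : IsRealForm V) : E →L[ℝ] V :=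
  hV.reₗ.toContinuousLinearMap

/-- The imaginary part `E → V` with respect to the real form `V`, as `-Re (i z)`. -/
noncomputable def IsRealForm.im (hV : IsRealForm V) : E →L[ℝ] V :=
  -(hV.re.comp (Complex.I • ContinuousLinearMap.id ℝ E))

theorem IsRealForm.im_apply (hV : IsRealForm V) (z : E) : hV.im z = -hV.re (Complex.I • z) := rfl

theorem IsRealForm.re_eq (hV : IsRealForm V) (x y : V) :
    hV.re ((x : E) + Complex.I • (y : E)) = x :=
  (hV.ext (hV ((x : E) + Complex.I • (y : E))).choose_spec.1).1.symm

theorem IsRealForm.im_eq (hV : IsRealForm V) (x y : V) :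
    hV.im ((x : E) + Complex.I • (y : E)) = y := by
  have := hV.re_eq (-y) x
  rw [hV.im_apply, smul_add, smul_smul, Complex.I_mul_I, neg_one_smul, add_comm]
  simpa using congrArg Neg.neg this

@[simp] theorem IsRealForm.re_coe (hV : IsRealForm V) (x : V) : hV.re (x : E) = x := by
  simpa using hV.re_eq x 0

@[simp] theorem IsRealForm.im_coe (hV : IsRealForm V) (x : V) : hV.im (x : E) = 0 := by
  simpa using hV.im_eq x 0

@[simp] theorem IsRealForm.re_I_smul (hV : IsRealForm V) (z : E) :
    hV.re (Complex.I • z) = -hV.im z := by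
  rw [hV.im_apply, neg_neg]

@[simp] theorem IsRealForm.im_I_smul (hV : IsRealForm V) (z : E) :
    hV.im (Complex.I • z) = hV.re z := by
  rw [hV.im_apply, smul_smul, Complex.I_mul_I]; simp

theorem IsRealForm.re_add_im (hV : IsRealForm V) (z : E) :
    (hV.re z : E) + Complex.I • (hV.im z : E) = z := by
  obtain ⟨p, hp, -⟩ := hV z
  rw [hp, hV.re_eq, hV.im_eq]

omit [FiniteDimensional ℂ E] in
theorem I_smul_real_smul (r : ℝ) (x : E) : Complex.I • r • x = r • Complex.I • x :=
  smul_comm _ _ _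

omit [FiniteDimensional ℂ E] in
theorem I_smul_I_smul (x : E) : Complex.I • Complex.I • x = -x := by
  rw [smul_smul, Complex.I_mul_I, neg_one_smul]

omit [FiniteDimensional ℂ E] in
theorem complex_smul_eq (c : ℂ) (x : E) : c • x = c.re • x + c.im • Complex.I • x := by
  conv_lhs => rw [← Complex.re_add_im c, add_smul, mul_smul]
  simp only [Complex.coe_smul]

theorem IsRealForm.re_smul (hV : IsRealForm V) (c : ℂ) (z : E) :
    hV.re (c • z) = c.re • hV.re z - c.im • hV.im z := by
  rw [complex_smul_eq, map_add, map_smul, map_smul, hV.re_I_smul, smul_neg, sub_eq_add_neg]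

theorem IsRealForm.im_smul (hV : IsRealForm V) (c : ℂ) (z : E) :
    hV.im (c • z) = c.re • hV.im z + c.im • hV.re z := by
  rw [complex_smul_eq, map_add, map_smul, map_smul, hV.im_I_smul]

/-- The complex linear map which agrees with the real linear map `L` on `iV`. If `L` is a
derivative within a tube of a CR map `f`, this is the complex derivative of `f` within the tube,
whatever values `L` takes off the tangent space. -/
noncomputable def IsRealForm.complexify (hV : IsRealForm V) (L : E →L[ℝ] E) : E →L[ℂ] E :=
  LinearMap.toContinuousLinearMap
    { toFun := fun u => L (Complex.I • (hV.im u : E)) - Complex.I • L (Complex.I • (hV.re u : E))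
      map_add' := fun u v => by simp only [map_add, Submodule.coe_add, smul_add]; abel
      map_smul' := fun c u => by
        rw [hV.re_smul, hV.im_smul]
        simp only [Submodule.coe_add, Submodule.coe_sub, Submodule.coe_smul, smul_add, smul_sub,
          map_add, map_sub, I_smul_real_smul, map_smul, RingHom.id_apply]
        rw [complex_smul_eq c, complex_smul_eq c, I_smul_I_smul]
        module }

theorem IsRealForm.complexify_apply (hV : IsRealForm V) (L : E →L[ℝ] E) (u : E) :
    hV.complexify L u =
      L (Complex.I • (hV.im u : E)) - Complex.I • L (Complex.I • (hV.re u : E)) := rfl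

/-- The map `L ↦ hV.complexify L u`, as a continuous linear map in `L`, so that it can be composed
with derivatives and analytic maps. -/
noncomputable def IsRealForm.complexifyEval (hV : IsRealForm V) (u : E) :
    (E →L[ℝ] E) →L[ℝ] E :=
  ContinuousLinearMap.apply ℝ E (Complex.I • (hV.im u : E)) -
    (Complex.I • ContinuousLinearMap.id ℝ E).comp
      (ContinuousLinearMap.apply ℝ E (Complex.I • (hV.re u : E)))

@[simp] theorem IsRealForm.complexifyEval_apply (hV : IsRealForm V) (L : E →L[ℝ] E) (u : E) :
    hV.complexifyEval u L = hV.complexify L u := rfl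

theorem IsRealForm.complexify_restrictScalars (hV : IsRealForm V) (C : E →L[ℂ] E) :
    hV.complexify (C.restrictScalars ℝ) = C := by
  ext u
  rw [hV.complexify_apply]
  simp only [ContinuousLinearMap.coe_restrictScalars', map_smul, I_smul_I_smul]
  rw [sub_neg_eq_add, add_comm, ← map_smul, ← map_add, hV.re_add_im]

variable {F : Set V}

theorem mem_tube_iff (hV : IsRealForm V) {z : E} : z ∈ tube V F ↔ hV.re z ∈ F := by
  constructor
  · rintro ⟨x, hx, v, rfl⟩
    rwa [hV.re_eq]
  · intro h
    exact ⟨hV.re z, h, hV.im z, (hV.re_add_im z).symm⟩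

theorem mem_tangentVectors_tube_iff (hV : IsRealForm V) {z w : E} :
    w ∈ tangentVectors (tube V F) z ↔ hV.re w ∈ tangentVectors F (hV.re z) := by
  constructor
  · rintro ⟨γ, h0, hγ, hd⟩
    exact ⟨fun t => hV.re (γ t), by simp [h0], hγ.mono fun t ht => (mem_tube_iff hV).1 ht,
      hV.re.hasFDerivAt.comp_hasDerivAt _ hd⟩
  · rintro ⟨γ, h0, hγ, hd⟩
    refine ⟨fun t => (γ t : E) + Complex.I • ((hV.im z + t • hV.im w : V) : E), ?_,
      hγ.mono fun t ht => ⟨γ t, ht, _, rfl⟩, ?_⟩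
    · simp only [h0, zero_smul, add_zero]; exact hV.re_add_im z
    · have h1 : HasDerivAt (fun t => (γ t : E)) (hV.re w : E) 0 :=
        V.subtypeL.hasFDerivAt.comp_hasDerivAt (0 : ℝ) hd
      have h2 : HasDerivAt (fun t : ℝ => Complex.I • ((hV.im z + t • hV.im w : V) : E))
          (Complex.I • (hV.im w : E)) 0 := by
        have h3 : HasDerivAt (fun t : ℝ => hV.im z + t • hV.im w) (hV.im w) 0 := by
          simpa using ((hasDerivAt_id (0 : ℝ)).smul_const (hV.im w)).const_add (hV.im z)
        exact (V.subtypeL.hasFDerivAt.comp_hasDerivAt (0 : ℝ) h3).const_smul Complex.I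
      have := h1.add h2
      rwa [hV.re_add_im] at this

/-- Near each of its points, a tube over an analytic submanifold has a real-analytic defining
function, the kernel of whose derivative is the tangent space. The function is obtained from a
straightening chart of `F` followed by a projection along the straightened submanifold. -/
theorem exists_defining (hV : IsRealForm V) (hF : IsAnalyticSubmanifold F) {z : E}
    (hz : z ∈ tube V F) :
    ∃ ρ : E → V, AnalyticAt ℝ ρ z ∧ ∀ᶠ z' in 𝓝[tube V F] z, ρ z' = 0 ∧
      ∀ w, w ∈ tangentVectors (tube V F) z' ↔ fderiv ℝ ρ z' w = 0 := by
  obtain ⟨Y, e, hxe, he, he', hS⟩ := hF _ ((mem_tube_iff hV).1 hz)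
  obtain ⟨q, hq⟩ := exists_clm_ker_eq Y
  refine ⟨fun z' => q (e (hV.re z')), ?_, ?_⟩
  · exact (q.analyticAt _).fun_comp ((he _ hxe).fun_comp (hV.re.analyticAt z))
  · have h1 : ∀ᶠ z' in 𝓝[tube V F] z, hV.re z' ∈ e.source :=
      nhdsWithin_le_nhds (hV.re.continuous.continuousAt.eventually (e.open_source.mem_nhds hxe))
    filter_upwards [h1, self_mem_nhdsWithin] with z' hz' hzM
    have hzF := (mem_tube_iff hV).1 hzM
    refine ⟨(hq _).2 ((hS _ hz').1 hzF), fun w => ?_⟩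
    rw [mem_tangentVectors_tube_iff hV, mem_tangentVectors_iff he he' hS hq hzF hz']
    have : HasFDerivAt (fun z' => q (e (hV.re z')))
        (q.comp ((fderiv ℝ e (hV.re z')).comp hV.re)) z' :=
      q.hasFDerivAt.comp z' ((he _ hz').differentiableAt.hasFDerivAt.comp z' hV.re.hasFDerivAt)
    rw [this.fderiv]
    rfl

theorem I_smul_mem_tangentVectors (hV : IsRealForm V) {z : E} (hz : z ∈ tube V F) (v : V) :
    Complex.I • (v : E) ∈ tangentVectors (tube V F) z := by
  rw [mem_tangentVectors_tube_iff hV]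
  exact ⟨fun _ => hV.re z, rfl, Eventually.of_forall fun _ => (mem_tube_iff hV).1 hz, by
    simpa using hasDerivAt_const _ _⟩

omit [FiniteDimensional ℂ E] in
theorem add_I_smul_mem_tube {z : E} (hz : z ∈ tube V F) (v : V) :
    z + Complex.I • (v : E) ∈ tube V F := by
  obtain ⟨x, hx, y, rfl⟩ := hz
  exact ⟨x, hx, y + v, by push_cast; rw [smul_add]; abel⟩

theorem mem_tangentVectors_add_I_smul (hV : IsRealForm V) {z w : E} (v : V) :
    w ∈ tangentVectors (tube V F) (z + Complex.I • (v : E)) ↔ w ∈ tangentVectors (tube V F) z := by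
  rw [mem_tangentVectors_tube_iff hV, mem_tangentVectors_tube_iff hV]
  simp

theorem self_mem_tangentVectors (hV : IsRealForm V) (hFc : IsConical F) {z : E}
    (hz : z ∈ tube V F) : z ∈ tangentVectors (tube V F) z := by
  rw [mem_tangentVectors_tube_iff hV]
  exact hFc _ ((mem_tube_iff hV).1 hz)

omit [FiniteDimensional ℂ E] in
theorem hasDerivAt_of_hasFDerivWithinAt {G : Type*} [NormedAddCommGroup G] [NormedSpace ℝ G]
    {M : Set E} {z : E} {f : E → G} {L : E →L[ℝ] G}
    (h : HasFDerivWithinAt f L M z) {γ : ℝ → E} {w : E} (h0 : γ 0 = z)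
    (hγ : ∀ᶠ t in 𝓝 (0 : ℝ), γ t ∈ M) (hd : HasDerivAt γ w 0) :
    HasDerivAt (fun t => f (γ t)) (L w) 0 := by
  subst h0
  have h1 : HasDerivWithinAt γ w (γ ⁻¹' M) 0 := hd.hasDerivWithinAt
  have h2 := HasFDerivWithinAt.comp_hasDerivWithinAt (0 : ℝ) h h1 (mapsTo_preimage _ _)
  exact h2.hasDerivAt hγ

omit [FiniteDimensional ℂ E] in
theorem eq_on_tangentVectors {G : Type*} [NormedAddCommGroup G] [NormedSpace ℝ G]
    {M : Set E} {z : E} {f : E → G} {L L' : E →L[ℝ] G}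
    (h : HasFDerivWithinAt f L M z) (h' : HasFDerivWithinAt f L' M z) {w : E}
    (hw : w ∈ tangentVectors M z) : L w = L' w := by
  obtain ⟨γ, h0, hγ, hd⟩ := hw
  exact (hasDerivAt_of_hasFDerivWithinAt h h0 hγ hd).unique
    (hasDerivAt_of_hasFDerivWithinAt h' h0 hγ hd)

/-- A derivative within a tube may be changed arbitrarily off the tangent space: the difference of
the two linear maps is the derivative of a linear function of a defining function, which vanishes
on the tube. -/
theorem hasFDerivWithinAt_of_eq_on_tangentVectors (hV : IsRealForm V)
    (hF : IsAnalyticSubmanifold F) {z : E} (hz : z ∈ tube V F) {f : E → E} {L L' : E →L[ℝ] E}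
    (h : HasFDerivWithinAt f L (tube V F) z)
    (hL : ∀ w ∈ tangentVectors (tube V F) z, L w = L' w) :
    HasFDerivWithinAt f L' (tube V F) z := by
  obtain ⟨ρ, hρ, hρM⟩ := exists_defining hV hF hz
  obtain ⟨r, hr⟩ : ∃ r : V →ₗ[ℝ] E, r ∘ₗ (fderiv ℝ ρ z : E →ₗ[ℝ] V) = ((L' - L : E →L[ℝ] E) : E →ₗ[ℝ] E) := by
    apply exists_comp_eq_of_ker_le
    intro w hw
    have := hL w (((hρM.self_of_nhdsWithin hz).2 w).2 hw)
    simp [this]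
  let R : V →L[ℝ] E := r.toContinuousLinearMap
  have h1 : HasFDerivWithinAt (fun z' => R (ρ z')) (L' - L) (tube V F) z := by
    have : HasFDerivWithinAt (fun z' => R (ρ z')) (R.comp (fderiv ℝ ρ z)) (tube V F) z :=
      R.hasFDerivAt.comp_hasFDerivWithinAt z hρ.differentiableAt.hasFDerivAt.hasFDerivWithinAt
    convert this
    ext w
    exact (congrArg (fun l : E →ₗ[ℝ] E => l w) hr).symm
  -- `R ∘ ρ` is zero on the tube but has derivative `L' - L`.
  have h2 := h.add h1
  rw [add_sub_cancel] at h2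
  refine h2.congr_of_eventuallyEq ?_ ?_
  · filter_upwards [hρM] with z' hz'
    simp [hz'.1]
  · simp [(hρM.self_of_nhdsWithin hz).1]

theorem uniqueDiffWithinAt_tube (hV : IsRealForm V) {z : E} (hz : z ∈ tube V F) :
    UniqueDiffWithinAt ℂ (tube V F) z := by
  refine ⟨?_, subset_closure hz⟩
  have h1 : ∀ v : V, Complex.I • (v : E) ∈ tangentConeAt ℂ (tube V F) z := by
    intro v
    refine mem_tangentConeAt_of_seq atTop (fun n : ℕ => ((n : ℂ) + 1))
      (fun n : ℕ => ((n : ℝ) + 1)⁻¹ • (Complex.I • (v : E))) ?_ ?_ ?_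
    · have : Tendsto (fun n : ℕ => ((n : ℝ) + 1)⁻¹) atTop (𝓝 0) := by
        simpa using tendsto_one_div_add_atTop_nhds_zero_nat (𝕜 := ℝ)
      simpa using this.smul_const (Complex.I • (v : E))
    · refine Eventually.of_forall fun n => ?_
      have := add_I_smul_mem_tube hz ((((n : ℝ) + 1)⁻¹ : ℝ) • v)
      rwa [Submodule.coe_smul, smul_comm] at this
    · refine tendsto_const_nhds.congr fun n => ?_
      rw [← Complex.coe_smul, smul_smul]
      have : ((n : ℂ) + 1) ≠ 0 := Nat.cast_add_one_ne_zero n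
      push_cast
      rw [mul_inv_cancel₀ this, one_smul]
  have h2 : Submodule.span ℂ (tangentConeAt ℂ (tube V F) z) = ⊤ := by
    rw [eq_top_iff]
    rintro w -
    have h3 : ∀ v : V, (v : E) ∈ Submodule.span ℂ (tangentConeAt ℂ (tube V F) z) := by
      intro v
      have := Submodule.smul_mem _ (-Complex.I) (Submodule.subset_span (h1 v))
      rwa [smul_smul, neg_mul, Complex.I_mul_I, neg_neg, one_smul] at this
    rw [← hV.re_add_im w]
    exact Submodule.add_mem _ (h3 _) (Submodule.smul_mem _ _ (h3 _))
  rw [h2]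
  exact dense_univ

end RealForm

/-! ### CR functions as functions complex differentiable within a tube -/

section CRFunctions

variable {E : Type*} [NormedAddCommGroup E] [NormedSpace ℂ E] {V : Submodule ℝ E}
  [FiniteDimensional ℂ E] {F : Set V}

theorem complexify_eq_of_eq_I_smul (hV : IsRealForm V) {L L' : E →L[ℝ] E}
    (h : ∀ v : V, L (Complex.I • (v : E)) = L' (Complex.I • (v : E))) :
    hV.complexify L = hV.complexify L' := by
  ext u
  rw [hV.complexify_apply, hV.complexify_apply, h, h]

theorem fderivWithin_eq_complexify (hV : IsRealForm V) {z : E} (hz : z ∈ tube V F)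
    {f : E → E} {L : E →L[ℝ] E} (hf : DifferentiableWithinAt ℂ f (tube V F) z)
    (hL : HasFDerivWithinAt f L (tube V F) z) :
    fderivWithin ℂ f (tube V F) z = hV.complexify L := by
  rw [← hV.complexify_restrictScalars (fderivWithin ℂ f (tube V F) z)]
  exact complexify_eq_of_eq_I_smul hV fun v =>
    eq_on_tangentVectors (hf.hasFDerivWithinAt.restrictScalars ℝ) hL
      (I_smul_mem_tangentVectors hV hz v)

/-- A map whose derivative is complex linear on the tangent space, in the sense that it agrees there
with its complexification, is complex differentiable within the tube. -/
theorem hasFDerivWithinAt_complexify (hV : IsRealForm V) (hF : IsAnalyticSubmanifold F)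
    {z : E} (hz : z ∈ tube V F) {f : E → E} {L : E →L[ℝ] E}
    (hL : HasFDerivWithinAt f L (tube V F) z)
    (h : ∀ w ∈ tangentVectors (tube V F) z, L w = hV.complexify L w) :
    HasFDerivWithinAt f (hV.complexify L) (tube V F) z := by
  have h1 : HasFDerivWithinAt f ((hV.complexify L).restrictScalars ℝ) (tube V F) z :=
    hasFDerivWithinAt_of_eq_on_tangentVectors hV hF hz hL h
  exact HasFDerivWithinAt.of_restrictScalars ℝ h1 rfl

theorem eq_complexify_of_mem_tangentVectors (hV : IsRealForm V) {z : E}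
    (hz : z ∈ tube V F)
    {f : E → E} {L : E →L[ℝ] E} (hf : DifferentiableWithinAt ℂ f (tube V F) z)
    (hL : HasFDerivWithinAt f L (tube V F) z) {w : E} (hw : w ∈ tangentVectors (tube V F) z) :
    L w = hV.complexify L w := by
  rw [← fderivWithin_eq_complexify hV hz hf hL]
  exact eq_on_tangentVectors hL (hf.hasFDerivWithinAt.restrictScalars ℝ) hw

/-- `f : M → E` is real analytic and CR at `z`. The CR condition is encoded as complex
differentiability within `M`, which on a tube over an analytic submanifold is equivalent to complex
linearity of the differential on `H_z M`; see `IsCRAt.isCRFunctionAt`. -/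
def IsCRFunctionAt (M : Set E) (f : E → E) (z : E) : Prop :=
  AnalyticWithinAt ℝ f M z ∧ DifferentiableWithinAt ℂ f M z

omit [FiniteDimensional ℂ E] in
/-- A function analytic within `M` agrees near `z` on `M` with a function analytic near `z`, whose
derivatives are derivatives of the given function within `M`. -/
theorem exists_local_extension {E G : Type*} [NormedAddCommGroup E] [NormedSpace ℝ E]
    [NormedAddCommGroup G] [NormedSpace ℝ G] [CompleteSpace G]
    {M : Set E} {f : E → G} {z : E} (hz : z ∈ M) (hf : AnalyticWithinAt ℝ f M z) :
    ∃ g : E → G, AnalyticAt ℝ g z ∧ ∀ᶠ z' in 𝓝[M] z, f z' = g z' ∧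
      HasFDerivWithinAt f (fderiv ℝ g z') M z' := by
  obtain ⟨g, hfg, hg⟩ := analyticWithinAt_iff_exists_analyticAt.1 hf
  rw [insert_eq_of_mem hz] at hfg
  refine ⟨g, hg, ?_⟩
  filter_upwards [hfg, eventually_eventually_nhdsWithin.2 hfg,
    nhdsWithin_le_nhds hg.eventually_analyticAt] with z' h1 h2 h3
  exact ⟨h1, h3.differentiableAt.hasFDerivAt.hasFDerivWithinAt.congr_of_eventuallyEq h2 h1⟩

omit [FiniteDimensional ℂ E] in
theorem eventually_tube_line {z : E} (hz : z ∈ tube V F) (v : V) {p : E → Prop}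
    (hp : ∀ᶠ z' in 𝓝[tube V F] z, p z') :
    ∀ᶠ t in 𝓝 (0 : ℝ), p (z + t • Complex.I • (v : E)) := by
  have h : Tendsto (fun t : ℝ => z + t • Complex.I • (v : E)) (𝓝 0) (𝓝[tube V F] z) := by
    refine tendsto_nhdsWithin_iff.2 ⟨?_, Eventually.of_forall fun t => ?_⟩
    · have : Continuous fun t : ℝ => z + t • Complex.I • (v : E) := by fun_prop
      simpa using this.tendsto 0
    · rw [← I_smul_real_smul]
      exact add_I_smul_mem_tube hz (t • v)
  exact h.eventually hp

/-- Directional derivatives of CR functions are CR functions, and they commute. For a direction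
`i v` the tube is invariant under translations, so the CR equations can be differentiated; the
general direction follows by complex linearity. -/
theorem IsCRFunctionAt.fderivWithin_apply (hV : IsRealForm V) (hF : IsAnalyticSubmanifold F)
    {z : E} (hz : z ∈ tube V F) {f : E → E}
    (hf : ∀ᶠ z' in 𝓝[tube V F] z, IsCRFunctionAt (tube V F) f z') :
    (∀ u, IsCRFunctionAt (tube V F) (fun z' => fderivWithin ℂ f (tube V F) z' u) z) ∧
    ∀ u w, fderivWithin ℂ (fun z' => fderivWithin ℂ f (tube V F) z' u) (tube V F) z w =
      fderivWithin ℂ (fun z' => fderivWithin ℂ f (tube V F) z' w) (tube V F) z u := by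
  obtain ⟨g, hg, hfg⟩ := exists_local_extension hz (hf.self_of_nhdsWithin hz).1
  set B := fderiv ℝ (fderiv ℝ g) z with hB
  have hgd : HasFDerivAt (fderiv ℝ g) B z := hg.fderiv.differentiableAt.hasFDerivAt
  have hsymm : ∀ u w, B u w = B w u := fun u w =>
    (hg.contDiffAt (n := 2)).isSymmSndFDerivAt (by simp) u w
  have hformula : ∀ u, (fun z' => fderivWithin ℂ f (tube V F) z' u) =ᶠ[𝓝[tube V F] z]
      fun z' => hV.complexifyEval u (fderiv ℝ g z') := by
    intro u
    filter_upwards [hf, hfg, self_mem_nhdsWithin] with z' h1 h2 h3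
    rw [fderivWithin_eq_complexify hV h3 h1.2 h2.2, hV.complexifyEval_apply]
  -- The CR equations hold along the line `z + t i v`, in the same tangent direction `w`;
  -- differentiate them at `t = 0`.
  have htan : ∀ v : V, ∀ w ∈ tangentVectors (tube V F) z,
      B (Complex.I • (v : E)) w = hV.complexify (B (Complex.I • (v : E))) w := by
    intro v w hw
    have hline : HasDerivAt (fun t : ℝ => fderiv ℝ g (z + t • Complex.I • (v : E)))
        (B (Complex.I • (v : E))) 0 := by
      have h1 : HasDerivAt (fun t : ℝ => z + t • Complex.I • (v : E)) (Complex.I • (v : E)) 0 := by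
        simpa using ((hasDerivAt_id (0 : ℝ)).smul_const (Complex.I • (v : E))).const_add z
      exact HasFDerivAt.comp_hasDerivAt_of_eq (x := (0 : ℝ)) hgd h1 (by simp)
    have h2 : HasDerivAt (fun t : ℝ => fderiv ℝ g (z + t • Complex.I • (v : E)) w)
        (B (Complex.I • (v : E)) w) 0 :=
      (ContinuousLinearMap.apply ℝ E w).hasFDerivAt.comp_hasDerivAt (0 : ℝ) hline
    have h3 : HasDerivAt (fun t : ℝ => hV.complexifyEval w (fderiv ℝ g (z + t • Complex.I • (v : E))))
        (hV.complexifyEval w (B (Complex.I • (v : E)))) 0 :=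
      (hV.complexifyEval w).hasFDerivAt.comp_hasDerivAt (0 : ℝ) hline
    refine h2.unique (h3.congr_of_eventuallyEq ?_)
    filter_upwards [eventually_tube_line hz v hfg, eventually_tube_line hz v hf] with t ht1 ht2
    have hmem : z + t • Complex.I • (v : E) ∈ tube V F := by
      rw [← I_smul_real_smul]
      exact add_I_smul_mem_tube hz (t • v)
    refine eq_complexify_of_mem_tangentVectors hV hmem ht2.2 ht1.2 ?_
    rw [← I_smul_real_smul]
    exact (mem_tangentVectors_add_I_smul hV (t • v)).2 hw
  have hmain : ∀ u, HasFDerivWithinAt (fun z' => fderivWithin ℂ f (tube V F) z' u)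
      (hV.complexify ((hV.complexifyEval u).comp B)) (tube V F) z := by
    intro u
    have h1 : HasFDerivWithinAt (fun z' => hV.complexifyEval u (fderiv ℝ g z'))
        ((hV.complexifyEval u).comp B) (tube V F) z :=
      ((hV.complexifyEval u).hasFDerivAt.comp z hgd).hasFDerivWithinAt
    refine hasFDerivWithinAt_complexify hV hF hz
      (h1.congr_of_eventuallyEq (hformula u) ((hformula u).self_of_nhdsWithin hz)) fun w hw => ?_
    have hsw : ∀ v : V, B w (Complex.I • (v : E)) =
        B (Complex.I • (hV.im w : E)) (Complex.I • (v : E)) -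
          Complex.I • B (Complex.I • (hV.re w : E)) (Complex.I • (v : E)) := by
      intro v
      rw [hsymm w, htan v w hw, hV.complexify_apply, hsymm _ (Complex.I • (v : E)),
        hsymm _ (Complex.I • (v : E))]
    simp only [hV.complexify_apply, ContinuousLinearMap.comp_apply, hV.complexifyEval_apply]
    rw [hsw, hsw]
    simp only [smul_sub]
    abel
  refine ⟨fun u => ⟨?_, (hmain u).differentiableWithinAt⟩, fun u w => ?_⟩
  · have h1 : AnalyticAt ℝ (fun z' => hV.complexifyEval u (fderiv ℝ g z')) z :=
      ((hV.complexifyEval u).analyticAt _).fun_comp hg.fderiv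
    refine h1.analyticWithinAt.congr_of_eventuallyEq_insert ?_
    rw [insert_eq_of_mem hz]
    exact hformula u
  · rw [(hmain u).fderivWithin (uniqueDiffWithinAt_tube hV hz),
      (hmain w).fderivWithin (uniqueDiffWithinAt_tube hV hz)]
    simp only [hV.complexify_apply, ContinuousLinearMap.comp_apply, hV.complexifyEval_apply]
    rw [hsymm _ (Complex.I • (hV.im u : E)), hsymm _ (Complex.I • (hV.im u : E)),
      hsymm _ (Complex.I • (hV.re u : E)), hsymm _ (Complex.I • (hV.re u : E))]
    simp only [smul_sub]
    abel

end CRFunctions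

/-- Uniqueness of the zero solution of a linear ODE on an open interval, where the coefficients need
not be bounded. -/
theorem eq_zero_of_linear_ode {G : Type*} [NormedAddCommGroup G] [NormedSpace ℂ G]
    {ε : ℝ} {C : ℝ → G →L[ℂ] G} (hC : ContinuousOn C (Ioo (-ε) ε)) {X : ℝ → G}
    (hX : ∀ t ∈ Ioo (-ε) ε, HasDerivAt X (C t (X t)) t) (h0 : X 0 = 0) :
    ∀ t ∈ Ioo (-ε) ε, X t = 0 := by
  intro t ht
  -- On a compact subinterval containing `0` and `t` the coefficients are bounded, hence uniformly
  -- Lipschitz.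
  obtain ⟨c, hc1, hc2⟩ := exists_between (abs_lt.2 ht)
  have hc0 : 0 < c := (abs_nonneg t).trans_lt hc1
  have hsub : Icc (-c) c ⊆ Ioo (-ε) ε := fun s hs => ⟨by linarith [hs.1], by linarith [hs.2]⟩
  obtain ⟨K, hK⟩ := isCompact_Icc.exists_bound_of_continuousOn (hC.mono hsub)
  have key := ODE_solution_unique_of_mem_Ioo (v := fun s x => C s x) (s := fun _ => univ)
    (K := K.toNNReal) (f := X) (g := fun _ => 0) (a := -c) (b := c) (t₀ := 0)
    (fun s hs => ((C s).lipschitz.weaken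
      (NNReal.le_toNNReal_of_coe_le (hK s (Ioo_subset_Icc_self hs)))).lipschitzOnWith)
    ⟨by linarith, hc0⟩
    (fun s hs => ⟨hX s (hsub (Ioo_subset_Icc_self hs)), mem_univ _⟩)
    (fun s hs => ⟨by simpa using hasDerivAt_const s (0 : G), mem_univ _⟩) h0
  exact key (abs_lt.1 hc1)

/-! ### CR vector fields: brackets and flows -/

section CRFields

variable {E : Type*} [NormedAddCommGroup E] [NormedSpace ℂ E] {V : Submodule ℝ E}
  [FiniteDimensional ℂ E] {F : Set V}

/-- The Lie bracket of two tangent fields is tangent: differentiate the equation `ρ'(z)(f z) = 0` for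
a defining function `ρ` along `g`, exchange the roles of `f` and `g`, and subtract. -/
theorem bracket_mem_tangentVectors (hV : IsRealForm V) (hF : IsAnalyticSubmanifold F) {z : E}
    (hz : z ∈ tube V F) {f g : E → E}
    (hf : DifferentiableWithinAt ℂ f (tube V F) z) (hg : DifferentiableWithinAt ℂ g (tube V F) z)
    (hft : ∀ᶠ z' in 𝓝[tube V F] z, f z' ∈ tangentVectors (tube V F) z')
    (hgt : ∀ᶠ z' in 𝓝[tube V F] z, g z' ∈ tangentVectors (tube V F) z') :
    fderivWithin ℂ g (tube V F) z (f z) - fderivWithin ℂ f (tube V F) z (g z) ∈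
      tangentVectors (tube V F) z := by
  obtain ⟨ρ, hρ, hρM⟩ := exists_defining hV hF hz
  set B := fderiv ℝ (fderiv ℝ ρ) z with hB
  have hρd : HasFDerivAt (fderiv ℝ ρ) B z := hρ.fderiv.differentiableAt.hasFDerivAt
  have hsymm : ∀ u w, B u w = B w u := fun u w =>
    (hρ.contDiffAt (n := 2)).isSymmSndFDerivAt (by simp) u w
  have key : ∀ f : E → E, DifferentiableWithinAt ℂ f (tube V F) z →
      (∀ᶠ z' in 𝓝[tube V F] z, f z' ∈ tangentVectors (tube V F) z') →
      ∀ w ∈ tangentVectors (tube V F) z,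
        fderiv ℝ ρ z (fderivWithin ℂ f (tube V F) z w) + B w (f z) = 0 := by
    intro f hf hft w hw
    have h1 := hρd.hasFDerivWithinAt.clm_apply (hf.hasFDerivWithinAt.restrictScalars ℝ)
    have h2 : (fun z' => fderiv ℝ ρ z' (f z')) =ᶠ[𝓝[tube V F] z] fun _ => 0 := by
      filter_upwards [hρM, hft] with z' h1 h2
      exact (h1.2 _).1 h2
    have h3 : HasFDerivWithinAt (fun z' => fderiv ℝ ρ z' (f z')) (0 : E →L[ℝ] V) (tube V F) z :=
      (hasFDerivWithinAt_const (0 : V) z _).congr_of_eventuallyEq h2 (h2.self_of_nhdsWithin hz)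
    simpa using eq_on_tangentVectors h1 h3 hw
  have hzt := (hρM.self_of_nhdsWithin hz).2
  rw [hzt, map_sub]
  have h1 := key f hf hft _ (hgt.self_of_nhdsWithin hz)
  have h2 := key g hg hgt _ (hft.self_of_nhdsWithin hz)
  rw [hsymm] at h2
  rw [eq_neg_of_add_eq_zero_left h1, eq_neg_of_add_eq_zero_left h2, sub_self]

/-- A CR map between a tube and a set is complex differentiable within the tube. If `w` is tangent,
then `Re w` lies in `H_z M`, because all of `iV` is tangent. -/
theorem IsCRAt.isCRFunctionAt (hV : IsRealForm V) (hF : IsAnalyticSubmanifold F) {M' : Set E}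
    {z : E} (hz : z ∈ tube V F) {h : E → E} (ha : AnalyticWithinAt ℝ h (tube V F) z)
    (hh : IsCRAt (tube V F) M' h z) : IsCRFunctionAt (tube V F) h z := by
  obtain ⟨L, hL, hLH⟩ := hh
  refine ⟨ha, (hasFDerivWithinAt_complexify hV hF hz hL fun w hw => ?_).differentiableWithinAt⟩
  have h1 : (hV.re w : E) ∈ holTangent (tube V F) z := by
    refine ⟨?_, I_smul_mem_tangentVectors hV hz _⟩
    rw [mem_tangentVectors_tube_iff hV] at hw ⊢
    simpa using hw
  rw [hV.complexify_apply, (hLH _ h1).2, I_smul_I_smul, sub_neg_eq_add, add_comm, ← map_add,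
    hV.re_add_im]

omit [NormedSpace ℂ E] [FiniteDimensional ℂ E] in
theorem nhdsWithin_Ioo_prod {M W : Set E} (hW : IsOpen W) {z : E} (hz : z ∈ W) {ε t : ℝ}
    (ht : t ∈ Ioo (-ε) ε) :
    𝓝[Ioo (-ε) ε ×ˢ (M ∩ W)] (t, z) = 𝓝 t ×ˢ 𝓝[M] z := by
  rw [nhdsWithin_prod_eq, isOpen_Ioo.nhdsWithin_eq ht,
    nhdsWithin_inter_of_mem' (nhdsWithin_le_nhds (hW.mem_nhds hz))]

omit [FiniteDimensional ℂ E] in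
/-- The linearized flow equation: the image `A(t)` of a tangent vector `w`, represented by a curve
`γ`, under the differential of the flow satisfies `A' = f'(Φ_t z) A`. The mixed derivatives are
exchanged for a local real-analytic extension `G` of `Φ`. -/
theorem IsLocalFlow.exists_fderiv [CompleteSpace E] {M U W : Set E} {f : E → E} {ε : ℝ} {Φ : ℝ → E → E}
    (hW : IsOpen W) (hΦ : IsLocalFlow M U f W ε Φ)
    (hf : ∀ z ∈ M ∩ U, DifferentiableWithinAt ℂ f M z) {z : E} (hz : z ∈ M ∩ W) {t₀ : ℝ}
    (ht₀ : t₀ ∈ Ioo (-ε) ε) :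
    ∃ L : E →L[ℝ] E, HasFDerivWithinAt (Φ t₀) L M z ∧
      ∀ (γ : ℝ → E) (w : E), γ 0 = z → (∀ᶠ s in 𝓝 (0 : ℝ), γ s ∈ M) → HasDerivAt γ w 0 →
        deriv (fun s => Φ t₀ (γ s)) 0 = L w ∧
        HasDerivAt (fun t => deriv (fun s => Φ t (γ s)) 0)
          (fderivWithin ℂ f M (Φ t₀ z) (L w)) t₀ := by
  obtain ⟨G, hG, hGev⟩ := exists_local_extension
    (M := Ioo (-ε) ε ×ˢ (M ∩ W)) (z := (t₀, z)) ⟨ht₀, hz⟩ (hΦ.1 (t₀, z) ⟨ht₀, hz⟩)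
  rw [nhdsWithin_Ioo_prod hW hz.2 ht₀] at hGev
  have hGeq : ∀ᶠ p in 𝓝 t₀ ×ˢ 𝓝[M] z, Φ p.1 p.2 = G p := hGev.mono fun p hp => hp.1
  have hslice : ∀ t, (∀ᶠ z' in 𝓝[M] z, Φ t z' = G (t, z')) → DifferentiableAt ℝ G (t, z) →
      HasFDerivWithinAt (Φ t) ((fderiv ℝ G (t, z)).comp (ContinuousLinearMap.inr ℝ ℝ E)) M z := by
    intro t h1 h2
    have h3 : HasFDerivAt (fun z' => G (t, z'))
        ((fderiv ℝ G (t, z)).comp (ContinuousLinearMap.inr ℝ ℝ E)) z :=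
      HasFDerivAt.comp z h2.hasFDerivAt (hasFDerivAt_prodMk_right t z)
    exact h3.hasFDerivWithinAt.congr_of_eventuallyEq h1 (h1.self_of_nhdsWithin hz.1)
  have hev1 : ∀ᶠ t in 𝓝 t₀, ∀ᶠ z' in 𝓝[M] z, Φ t z' = G (t, z') := hGeq.curry
  have hev2 : ∀ᶠ t in 𝓝 t₀, AnalyticAt ℝ G (t, z) :=
    (Continuous.prodMk_left z).continuousAt.eventually hG.eventually_analyticAt
  have hL := hslice t₀ hev1.self_of_nhds hG.differentiableAt
  refine ⟨_, hL, fun γ w h0 hγ hd => ⟨(hasDerivAt_of_hasFDerivWithinAt hL h0 hγ hd).deriv, ?_⟩⟩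
  set L := (fderiv ℝ G (t₀, z)).comp (ContinuousLinearMap.inr ℝ ℝ E) with hLdef
  set B := fderiv ℝ (fderiv ℝ G) (t₀, z) with hB
  have hGd : HasFDerivAt (fderiv ℝ G) B (t₀, z) := hG.fderiv.differentiableAt.hasFDerivAt
  have hsymm : B (1, 0) (0, w) = B (0, w) (1, 0) :=
    (hG.contDiffAt (n := 2)).isSymmSndFDerivAt (by simp) _ _
  have hA : (fun t => deriv (fun s => Φ t (γ s)) 0) =ᶠ[𝓝 t₀]
      fun t => fderiv ℝ G (t, z) (0, w) := by
    filter_upwards [hev1, hev2] with t h1 h2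
    exact (hasDerivAt_of_hasFDerivWithinAt (hslice t h1 h2.differentiableAt) h0 hγ hd).deriv
  have hA' : HasDerivAt (fun t => fderiv ℝ G (t, z) (0, w)) (B (1, 0) (0, w)) t₀ := by
    have h1 : HasDerivAt (fun t : ℝ => (t, z)) ((1 : ℝ), (0 : E)) t₀ :=
      (hasDerivAt_id t₀).prodMk (hasDerivAt_const t₀ z)
    have h2 : HasDerivAt (fun t => fderiv ℝ G (t, z)) (B (1, 0)) t₀ :=
      HasFDerivAt.comp_hasDerivAt t₀ hGd h1
    exact (ContinuousLinearMap.apply ℝ E ((0 : ℝ), w)).hasFDerivAt.comp_hasDerivAt t₀ h2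
  have hB1 : HasDerivAt (fun s => fderiv ℝ G (t₀, γ s) (1, 0)) (B (0, w) (1, 0)) 0 := by
    have h1 : HasDerivAt (fun s : ℝ => (t₀, γ s)) ((0 : ℝ), w) 0 :=
      (hasDerivAt_const (0 : ℝ) t₀).prodMk hd
    have h2 : HasDerivAt (fun s => fderiv ℝ G (t₀, γ s)) (B (0, w)) 0 :=
      HasFDerivAt.comp_hasDerivAt_of_eq (x := (0 : ℝ)) hGd h1 (by simp [h0])
    exact (ContinuousLinearMap.apply ℝ E ((1 : ℝ), (0 : E))).hasFDerivAt.comp_hasDerivAt (0 : ℝ) h2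
  have hγM : Tendsto γ (𝓝 0) (𝓝[M] z) :=
    tendsto_nhdsWithin_iff.2 ⟨by simpa [h0] using hd.continuousAt.tendsto, hγ⟩
  have hγW : ∀ᶠ s in 𝓝 (0 : ℝ), γ s ∈ W :=
    (tendsto_nhds_of_tendsto_nhdsWithin hγM).eventually (hW.mem_nhds hz.2)
  have hev3 : ∀ᶠ s in 𝓝 (0 : ℝ), ∀ᶠ t in 𝓝 t₀, Φ t (γ s) = G (t, γ s) := by
    refine hγM.eventually (p := fun z' => ∀ᶠ t in 𝓝 t₀, Φ t z' = G (t, z')) ?_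
    have : ∀ᶠ q in 𝓝[M] z ×ˢ 𝓝 t₀, Φ q.2 q.1 = G (q.2, q.1) := by
      rw [prod_comm, eventually_map]
      exact hGeq
    exact this.curry
  have hev4 : ∀ᶠ s in 𝓝 (0 : ℝ), AnalyticAt ℝ G (t₀, γ s) := by
    have : Tendsto (fun s => (t₀, γ s)) (𝓝 0) (𝓝 (t₀, z)) :=
      tendsto_const_nhds.prodMk_nhds (tendsto_nhds_of_tendsto_nhdsWithin hγM)
    exact this.eventually hG.eventually_analyticAt
  have hBeq : (fun s => f (Φ t₀ (γ s))) =ᶠ[𝓝 0] fun s => fderiv ℝ G (t₀, γ s) (1, 0) := by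
    filter_upwards [hev3, hev4, hγ, hγW] with s h1 h2 h3 h4
    have h5 : HasDerivAt (fun t => Φ t (γ s)) (f (Φ t₀ (γ s))) t₀ :=
      ((hΦ.2 _ ⟨h3, h4⟩).2 t₀ ht₀).2
    have h6 : HasDerivAt (fun t : ℝ => (t, γ s)) ((1 : ℝ), (0 : E)) t₀ :=
      (hasDerivAt_id t₀).prodMk (hasDerivAt_const t₀ _)
    have h7 : HasDerivAt (fun t => G (t, γ s)) (fderiv ℝ G (t₀, γ s) (1, 0)) t₀ :=
      HasFDerivAt.comp_hasDerivAt t₀ h2.differentiableAt.hasFDerivAt h6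
    exact h5.unique (h7.congr_of_eventuallyEq h1)
  have hfin : HasDerivAt (fun s => f (Φ t₀ (γ s))) (fderivWithin ℂ f M (Φ t₀ z) (L w)) 0 := by
    have h1 := (hf _ ((hΦ.2 z hz).2 t₀ ht₀).1).hasFDerivWithinAt.restrictScalars ℝ
    refine hasDerivAt_of_hasFDerivWithinAt h1 (by simp [h0]) ?_
      (hasDerivAt_of_hasFDerivWithinAt hL h0 hγ hd)
    filter_upwards [hγ, hγW] with s h3 h4
    exact ((hΦ.2 _ ⟨h3, h4⟩).2 t₀ ht₀).1.1
  have h8 : fderivWithin ℂ f M (Φ t₀ z) (L w) = B (1, 0) (0, w) := by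
    rw [hsymm]
    exact hfin.unique (hB1.congr_of_eventuallyEq hBeq)
  rw [h8]
  exact hA'.congr_of_eventuallyEq hA

/-- Tangent fields that are CR functions are infinitesimal CR-transformations. For `v ∈ H_z M`, the
images of `v` and `i v` under the differential of the flow solve the same complex linear ODE, so
the second remains `i` times the first. -/
theorem isInfinitesimalCR_of_isCRFunctionAt (hV : IsRealForm V) (hF : IsAnalyticSubmanifold F)
    {U : Set E} (hU : IsOpen U) {f : E → E}
    (hf : ∀ z ∈ tube V F ∩ U, IsCRFunctionAt (tube V F) f z)
    (hft : ∀ z ∈ tube V F ∩ U, f z ∈ tangentVectors (tube V F) z) :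
    IsInfinitesimalCR (tube V F) U f := by
  refine ⟨fun z hz => (hf z hz).1.mono inter_subset_left, hft, ?_⟩
  intro W ε Φ hW hε hΦ t₀ ht₀ z hz
  have : CompleteSpace E := FiniteDimensional.complete ℂ E
  have hfd : ∀ z ∈ tube V F ∩ U, DifferentiableWithinAt ℂ f (tube V F) z := fun z hz => (hf z hz).2
  obtain ⟨L, hL, hLγ⟩ := hΦ.exists_fderiv hW hfd hz ht₀
  have hcont : ContinuousOn (fun t => fderivWithin ℂ f (tube V F) (Φ t z)) (Ioo (-ε) ε) := by
    rw [continuousOn_clm_apply]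
    intro u t ht
    have hmem := ((hΦ.2 z hz).2 t ht)
    have hcr : ∀ᶠ z' in 𝓝[tube V F] (Φ t z), IsCRFunctionAt (tube V F) f z' := by
      filter_upwards [self_mem_nhdsWithin, nhdsWithin_le_nhds (hU.mem_nhds hmem.1.2)] with z' h1 h2
      exact hf z' ⟨h1, h2⟩
    have h1 := (((IsCRFunctionAt.fderivWithin_apply hV hF hmem.1.1 hcr).1 u).2).continuousWithinAt
    exact h1.comp (f := fun t => Φ t z) (s := Ioo (-ε) ε) hmem.2.continuousAt.continuousWithinAt
      fun s hs => ((hΦ.2 z hz).2 s hs).1.1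
  refine ⟨L, hL, fun v hv => ?_⟩
  obtain ⟨⟨γ₁, h10, h1M, h1d⟩, ⟨γ₂, h20, h2M, h2d⟩⟩ := hv
  have hA : ∀ (γ : ℝ → E) (w : E), γ 0 = z → (∀ᶠ s in 𝓝 (0 : ℝ), γ s ∈ tube V F) →
      HasDerivAt γ w 0 →
      deriv (fun s => Φ 0 (γ s)) 0 = w ∧ ∀ t ∈ Ioo (-ε) ε,
        HasDerivAt (fun t => deriv (fun s => Φ t (γ s)) 0)
          (fderivWithin ℂ f (tube V F) (Φ t z) (deriv (fun s => Φ t (γ s)) 0)) t := by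
    intro γ w h0 hγ hd
    constructor
    · refine (hd.congr_of_eventuallyEq ?_).deriv
      have hγW : ∀ᶠ s in 𝓝 (0 : ℝ), γ s ∈ W :=
        hd.continuousAt.eventually (by rw [h0]; exact hW.mem_nhds hz.2)
      filter_upwards [hγ, hγW] with s h1 h2
      exact (hΦ.2 _ ⟨h1, h2⟩).1
    · intro t ht
      obtain ⟨L', -, hL'⟩ := hΦ.exists_fderiv hW hfd hz ht
      obtain ⟨h1, h2⟩ := hL' γ w h0 hγ hd
      rwa [h1]
  obtain ⟨hA1, hA1'⟩ := hA γ₁ v h10 h1M h1d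
  obtain ⟨hA2, hA2'⟩ := hA γ₂ _ h20 h2M h2d
  -- `X(t) = dΦ_t(i v) - i dΦ_t(v)` satisfies the linearized flow equation.
  have hzero := eq_zero_of_linear_ode hcont
    (X := fun t => deriv (fun s => Φ t (γ₂ s)) 0 - Complex.I • deriv (fun s => Φ t (γ₁ s)) 0)
    (fun t ht => by
      have := (hA2' t ht).sub ((hA1' t ht).const_smul Complex.I)
      rwa [← map_smul, ← map_sub] at this) (by simp only [hA1, hA2, sub_self]) t₀ ht₀
  have hLI : L (Complex.I • v) = Complex.I • L v := by
    rw [← (hLγ γ₁ v h10 h1M h1d).1, ← (hLγ γ₂ _ h20 h2M h2d).1]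
    exact sub_eq_zero.1 hzero
  have htan : ∀ w ∈ tangentVectors (tube V F) z, L w ∈ tangentVectors (tube V F) (Φ t₀ z) := by
    rintro w ⟨γ, h0, hγ, hd⟩
    refine ⟨fun s => Φ t₀ (γ s), by simp [h0], ?_, hasDerivAt_of_hasFDerivWithinAt hL h0 hγ hd⟩
    have hγW : ∀ᶠ s in 𝓝 (0 : ℝ), γ s ∈ W :=
      hd.continuousAt.eventually (by rw [h0]; exact hW.mem_nhds hz.2)
    filter_upwards [hγ, hγW] with s h1 h2
    exact ((hΦ.2 _ ⟨h1, h2⟩).2 t₀ ht₀).1.1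
  refine ⟨⟨htan _ ⟨γ₁, h10, h1M, h1d⟩, ?_⟩, hLI⟩
  rw [← hLI]
  exact htan _ ⟨γ₂, h20, h2M, h2d⟩

end CRFields

/-- If `[D, δ] = D` then every nonzero power `D ^ n` is an eigenvector of `[·, δ]` for the eigenvalue
`n`, and there are only finitely many eigenvalues. -/
theorem isNilpotent_of_commutator_eq_self {K W : Type*} [Field K] [CharZero K] [AddCommGroup W]
    [Module K W] [FiniteDimensional K W] {D δ : Module.End K W} (h : D * δ - δ * D = D) :
    IsNilpotent D := by
  by_contra hD
  let ad : Module.End K (Module.End K W) := LinearMap.mulRight K δ - LinearMap.mulLeft K δ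
  have had : ∀ n : ℕ, ad (D ^ n) = (n : K) • D ^ n := by
    intro n
    induction n with
    | zero => simp [ad]
    | succ n ih =>
      simp only [ad, LinearMap.sub_apply, LinearMap.mulRight_apply, LinearMap.mulLeft_apply] at ih ⊢
      have h1 : D ^ (n + 1) * δ - δ * D ^ (n + 1) =
          D ^ n * (D * δ - δ * D) + (D ^ n * δ - δ * D ^ n) * D := by
        rw [pow_succ]; noncomm_ring
      rw [h1, h, ih, smul_mul_assoc, ← pow_succ]
      push_cast
      rw [add_smul, one_smul, add_comm]
  have hev : ∀ n : ℕ, ad.HasEigenvalue (n : K) := fun n =>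
    Module.End.hasEigenvalue_of_hasEigenvector
      ⟨Module.End.mem_eigenspace_iff.2 (had n), fun h0 => hD ⟨n, h0⟩⟩
  exact (Set.infinite_range_of_injective (Nat.cast_injective (R := K)))
    ((Module.End.finite_hasEigenvalue ad).subset (by rintro _ ⟨n, rfl⟩; exact hev n))

/-! ### Local constancy and the Euler derivative -/

section Calculus

variable {E : Type*} [NormedAddCommGroup E] [NormedSpace ℂ E] {V : Submodule ℝ E}
  [FiniteDimensional ℂ E] {F : Set V}

/-- A function whose derivative within a tube vanishes is locally constant on the tube, which is
locally parametrized by a convex set. -/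
theorem eventually_eq_of_hasFDerivWithinAt_zero {G : Type*} [NormedAddCommGroup G]
    [NormedSpace ℝ G] (hV : IsRealForm V) (hF : IsAnalyticSubmanifold F) {a : E}
    (ha : a ∈ tube V F) {φ : E → G}
    (hφ : ∀ᶠ z in 𝓝[tube V F] a, HasFDerivWithinAt φ (0 : E →L[ℝ] G) (tube V F) z) :
    ∀ᶠ z in 𝓝[tube V F] a, φ z = φ a := by
  obtain ⟨Y, e, hxe, he, he', hS⟩ := hF _ ((mem_tube_iff hV).1 ha)
  set y₀ := e (hV.re a) with hy₀
  have hyt : y₀ ∈ e.target := e.map_source hxe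
  have hyY : y₀ ∈ Y := (hS _ hxe).1 ((mem_tube_iff hV).1 ha)
  let Ψ : V × V → E := fun p => (e.symm p.1 : E) + Complex.I • (p.2 : E)
  have hΨd : ∀ p : V × V, p.1 ∈ e.target → DifferentiableAt ℝ Ψ p := by
    intro p hp
    have h1 : DifferentiableAt ℝ (fun p : V × V => e.symm p.1) p :=
      (he' _ hp).differentiableAt.comp p differentiableAt_fst
    have h2 : DifferentiableAt ℝ (fun p : V × V => (e.symm p.1 : E)) p :=
      V.subtypeL.differentiableAt.comp p h1
    have h3 : DifferentiableAt ℝ (fun p : V × V => (p.2 : E)) p :=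
      V.subtypeL.differentiableAt.comp p differentiableAt_snd
    exact h2.add (h3.const_smul Complex.I)
  let S : Submodule ℝ (V × V) := Y.comap (LinearMap.fst ℝ V V)
  have hΨM : ∀ p : V × V, p.1 ∈ e.target → p ∈ S → Ψ p ∈ tube V F := by
    intro p hp hpS
    refine ⟨e.symm p.1, ?_, p.2, rfl⟩
    rw [hS _ (e.map_target hp), e.right_inv hp]
    exact hpS
  have hΨ0 : Ψ (y₀, hV.im a) = a := by
    simp only [Ψ, hy₀, e.left_inv hxe, hV.re_add_im]
  have htgt : ∀ᶠ p in 𝓝 (y₀, hV.im a), p.1 ∈ e.target :=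
    continuous_fst.continuousAt.eventually (e.open_target.mem_nhds hyt)
  have hΨt : Tendsto Ψ (𝓝[S] (y₀, hV.im a)) (𝓝[tube V F] a) := by
    refine tendsto_nhdsWithin_iff.2 ⟨?_, ?_⟩
    · have := (hΨd (y₀, hV.im a) hyt).continuousAt.tendsto
      rw [hΨ0] at this
      exact this.mono_left nhdsWithin_le_nhds
    · filter_upwards [self_mem_nhdsWithin, nhdsWithin_le_nhds htgt] with p h1 h2
      exact hΨM p h2 h1
  have hgood := eventually_nhdsWithin_iff.1 (hΨt.eventually hφ)
  obtain ⟨r, hr, hball⟩ := Metric.eventually_nhds_iff_ball.1 (hgood.and htgt)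
  have hconv : Convex ℝ ((S : Set (V × V)) ∩ Metric.ball (y₀, hV.im a) r) :=
    S.convex.inter (convex_ball _ _)
  have hconst : ∀ p ∈ (S : Set (V × V)) ∩ Metric.ball (y₀, hV.im a) r, φ (Ψ p) = φ a := by
    intro p hp
    have hd : ∀ q ∈ (S : Set (V × V)) ∩ Metric.ball (y₀, hV.im a) r,
        HasFDerivWithinAt (fun q => φ (Ψ q)) (0 : V × V →L[ℝ] G)
          ((S : Set (V × V)) ∩ Metric.ball (y₀, hV.im a) r) q := by
      intro q hq
      have h1 := (hball q hq.2).1 hq.1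
      have h2 := (hΨd q (hball q hq.2).2).hasFDerivAt.hasFDerivWithinAt
        (s := (S : Set (V × V)) ∩ Metric.ball (y₀, hV.im a) r)
      have h3 := HasFDerivWithinAt.comp q h1 h2 fun q' hq' => hΨM q' (hball q' hq'.2).2 hq'.1
      rwa [ContinuousLinearMap.zero_comp] at h3
    have := hconv.norm_image_sub_le_of_norm_hasFDerivWithin_le hd (C := 0) (by simp)
      (x := (y₀, hV.im a)) ⟨hyY, Metric.mem_ball_self hr⟩ hp
    rw [zero_mul, norm_le_zero_iff, sub_eq_zero, hΨ0] at this
    exact this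
  have hsrc : ∀ᶠ z in 𝓝[tube V F] a, hV.re z ∈ e.source :=
    nhdsWithin_le_nhds (hV.re.continuous.continuousAt.eventually (e.open_source.mem_nhds hxe))
  have hb : ∀ᶠ z in 𝓝[tube V F] a, (e (hV.re z), hV.im z) ∈ Metric.ball (y₀, hV.im a) r := by
    refine nhdsWithin_le_nhds ?_
    have : ContinuousAt (fun z => (e (hV.re z), hV.im z)) a :=
      ((e.continuousAt hxe).comp hV.re.continuous.continuousAt).prodMk
        hV.im.continuous.continuousAt
    exact this.eventually (Metric.ball_mem_nhds _ hr)
  filter_upwards [hsrc, hb, self_mem_nhdsWithin] with z h1 h2 h3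
  have h4 := hconst (e (hV.re z), hV.im z) ⟨(hS _ h1).1 ((mem_tube_iff hV).1 h3), h2⟩
  rwa [show Ψ (e (hV.re z), hV.im z) = z by simp only [Ψ, e.left_inv h1, hV.re_add_im]] at h4

theorem fderivWithin_self_apply_eq_sum {ι : Type*} [Fintype ι] (b : Module.Basis ι ℂ E) (C : E →L[ℂ] E)
    (w : E) : C w = ∑ i, LinearMap.toContinuousLinearMap (b.coord i) w • C (b i) := by
  conv_lhs => rw [← b.sum_repr w, map_sum]
  simp

omit [FiniteDimensional ℂ E] in
theorem IsCRFunctionAt.add {M : Set E} {f g : E → E} {z : E} (hf : IsCRFunctionAt M f z)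
    (hg : IsCRFunctionAt M g z) : IsCRFunctionAt M (f + g) z :=
  ⟨hf.1.add hg.1, hf.2.add hg.2⟩

omit [FiniteDimensional ℂ E] in
theorem isCRFunctionAt_zero {M : Set E} {z : E} : IsCRFunctionAt M (0 : E → E) z :=
  ⟨analyticWithinAt_const, differentiableWithinAt_const _⟩

omit [FiniteDimensional ℂ E] in
theorem IsCRFunctionAt.const_smul {M : Set E} {f : E → E} {z : E} (c : ℂ)
    (hf : IsCRFunctionAt M f z) : IsCRFunctionAt M (c • f) z :=
  ⟨((c • ContinuousLinearMap.id ℝ E).analyticAt _).comp_analyticWithinAt hf.1, hf.2.const_smul c⟩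

omit [FiniteDimensional ℂ E] in
theorem IsCRFunctionAt.sum_smul {ι : Type*} [Fintype ι] {M : Set E} {z : E} (c : ι → E →L[ℂ] ℂ)
    {g : ι → E → E} (hg : ∀ i, IsCRFunctionAt M (g i) z) :
    IsCRFunctionAt M (fun z' => ∑ i, c i z' • g i z') z := by
  constructor
  · have : ∀ i ∈ Finset.univ, AnalyticWithinAt ℝ (fun z' => c i z' • g i z') M z := fun i _ =>
      (((c i).restrictScalars ℝ).analyticAt z).analyticWithinAt.smul (hg i).1
    exact Finset.analyticWithinAt_fun_sum _ this
  · exact DifferentiableWithinAt.fun_sum fun i _ =>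
      (c i).differentiableAt.differentiableWithinAt.smul (hg i).2

/-- The derivative along the Euler field `z ↦ z` of a CR function is a CR function, and its
commutator with the derivative in direction `u` is the derivative in direction `u`. -/
theorem IsCRFunctionAt.fderivWithin_self (hV : IsRealForm V) (hF : IsAnalyticSubmanifold F)
    {z : E} (hz : z ∈ tube V F) {f : E → E}
    (hf : ∀ᶠ z' in 𝓝[tube V F] z, IsCRFunctionAt (tube V F) f z') :
    IsCRFunctionAt (tube V F) (fun z' => fderivWithin ℂ f (tube V F) z' z') z ∧
    ∀ u, fderivWithin ℂ (fun z' => fderivWithin ℂ f (tube V F) z' z') (tube V F) z u =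
      fderivWithin ℂ (fun z' => fderivWithin ℂ f (tube V F) z' u) (tube V F) z z +
        fderivWithin ℂ f (tube V F) z u := by
  let b := Module.finBasis ℂ E
  obtain ⟨hcr, hsymm⟩ := IsCRFunctionAt.fderivWithin_apply hV hF hz hf
  have heq : (fun z' => fderivWithin ℂ f (tube V F) z' z') = fun z' =>
      ∑ i, LinearMap.toContinuousLinearMap (b.coord i) z' • fderivWithin ℂ f (tube V F) z' (b i) :=
    funext fun z' => fderivWithin_self_apply_eq_sum b _ _
  refine ⟨?_, fun u => ?_⟩
  · rw [heq]
    exact IsCRFunctionAt.sum_smul _ fun i => hcr (b i)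
  · have hd : HasFDerivWithinAt (fun z' => ∑ i, LinearMap.toContinuousLinearMap (b.coord i) z' •
        fderivWithin ℂ f (tube V F) z' (b i)) _ (tube V F) z :=
      HasFDerivWithinAt.fun_sum fun i _ =>
        (LinearMap.toContinuousLinearMap (b.coord i)).hasFDerivAt.hasFDerivWithinAt.smul
          (hcr (b i)).2.hasFDerivWithinAt
    rw [heq, hd.fderivWithin (uniqueDiffWithinAt_tube hV hz)]
    rw [fderivWithin_self_apply_eq_sum b
      (fderivWithin ℂ (fun z' => fderivWithin ℂ f (tube V F) z' u) (tube V F) z) z,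
      fderivWithin_self_apply_eq_sum b (fderivWithin ℂ f (tube V F) z) u, ← Finset.sum_add_distrib]
    simp only [sum_apply]
    refine Finset.sum_congr rfl fun i _ => ?_
    rw [hsymm u (b i)]
    simp

end Calculus

/-! ### Polynomial maps -/

section Polynomial

variable {E : Type*} [NormedAddCommGroup E] [NormedSpace ℂ E]
  {G : Type*} [NormedAddCommGroup G] [NormedSpace ℂ G]
  {H : Type*} [NormedAddCommGroup H] [NormedSpace ℂ H]
  {K : Type*} [NormedAddCommGroup K] [NormedSpace ℂ K]

/-- An everywhere locally polynomial map is a polynomial map, by the identity theorem. -/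
theorem isPolynomialMap_of_cpolynomialOn [CompleteSpace G] {f : E → G}
    (hf : CPolynomialOn ℂ f univ) : IsPolynomialMap f := by
  obtain ⟨p, n, r, hp⟩ := hf 0 (mem_univ _)
  refine ⟨p, n, fun z => ?_⟩
  have hpa : AnalyticOnNhd ℂ (fun z => p.partialSum n z) univ := by
    intro z _
    refine Finset.analyticAt_fun_sum _ fun k _ => ?_
    exact (p k).cpolynomialAt.analyticAt.fun_comp
      ((ContinuousLinearMap.pi fun _ : Fin k => ContinuousLinearMap.id ℂ E).analyticAt z)
  have heq : f =ᶠ[𝓝 0] fun z => p.partialSum n z := by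
    filter_upwards [Metric.eball_mem_nhds (0 : E) hp.r_pos] with y hy
    simpa using hp.eq_partialSum y hy n le_rfl
  exact congrFun (hf.analyticOnNhd.eq_of_eventuallyEq hpa heq) z

theorem _root_.CPolynomialAt.clm_comp (L : G →L[ℂ] H) {f : E → G} {z : E} (hf : CPolynomialAt ℂ f z) :
    CPolynomialAt ℂ (fun z => L (f z)) z :=
  (L.cpolynomialAt _).comp hf

theorem _root_.CPolynomialAt.bilin (B : G →L[ℂ] H →L[ℂ] K) {f : E → G} {g : E → H} {z : E}
    (hf : CPolynomialAt ℂ f z) (hg : CPolynomialAt ℂ g z) :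
    CPolynomialAt ℂ (fun z => B (f z) (g z)) z := by
  have h1 : CPolynomialAt ℂ (fun z => (f z, g z)) z := by
    have h := (CPolynomialAt.clm_comp (ContinuousLinearMap.inl ℂ G H) hf).add
      (CPolynomialAt.clm_comp (ContinuousLinearMap.inr ℂ G H) hg)
    convert h using 2
    simp
  exact (B.uncurryBilinear.cpolynomialAt).comp
    (CPolynomialAt.clm_comp (ContinuousLinearMap.pi fun _ : Fin 2 => ContinuousLinearMap.id ℂ _) h1)

theorem _root_.CPolynomialAt.pow {A : Type*} [NormedRing A] [NormedAlgebra ℂ A] {f : E → A} {z : E}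
    (hf : CPolynomialAt ℂ f z) (n : ℕ) : CPolynomialAt ℂ (fun z => f z ^ n) z := by
  induction n with
  | zero => simpa using CPolynomialAt_const
  | succ n ih =>
    simp only [pow_succ]
    exact CPolynomialAt.bilin (ContinuousLinearMap.mul ℂ A) ih hf

theorem _root_.CPolynomialAt.sum {ι : Type*} (s : Finset ι) {f : ι → E → G} {z : E}
    (hf : ∀ i ∈ s, CPolynomialAt ℂ (f i) z) : CPolynomialAt ℂ (fun z => ∑ i ∈ s, f i z) z := by
  classical
  induction s using Finset.induction_on with
  | empty => simpa using CPolynomialAt_const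
  | insert i s hi ih =>
    simp only [Finset.sum_insert hi]
    exact (hf i (Finset.mem_insert_self _ _)).add
      (ih fun j hj => hf j (Finset.mem_insert_of_mem hj))

theorem _root_.CPolynomialAt.prod {ι : Type*} (s : Finset ι) {f : ι → E → ℂ} {z : E}
    (hf : ∀ i ∈ s, CPolynomialAt ℂ (f i) z) : CPolynomialAt ℂ (fun z => ∏ i ∈ s, f i z) z := by
  classical
  induction s using Finset.induction_on with
  | empty => simpa using CPolynomialAt_const
  | insert i s hi ih =>
    simp only [Finset.prod_insert hi]
    exact CPolynomialAt.bilin (ContinuousLinearMap.mul ℂ ℂ) (hf i (Finset.mem_insert_self _ _))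
      (ih fun j hj => hf j (Finset.mem_insert_of_mem hj))

theorem _root_.CPolynomialAt.det {ι : Type*} [Fintype ι] [DecidableEq ι] {A : E → Matrix ι ι ℂ} {z : E}
    (hA : ∀ i j, CPolynomialAt ℂ (fun z => A z i j) z) : CPolynomialAt ℂ (fun z => (A z).det) z := by
  simp only [Matrix.det_apply']
  exact CPolynomialAt.sum _ fun σ _ => CPolynomialAt.bilin (ContinuousLinearMap.mul ℂ ℂ)
    CPolynomialAt_const (CPolynomialAt.prod _ fun i _ => hA _ _)

end Polynomial

/-! ### Functions spanning a space stable under differentiation -/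

section Exponential

variable {E : Type*} [NormedAddCommGroup E] [NormedSpace ℂ E] {V : Submodule ℝ E}
  [FiniteDimensional ℂ E] {F : Set V}

theorem exp_eq_sum_of_pow_eq_zero {A : Type*} [NormedRing A] [NormedAlgebra ℂ A] {x : A} {N : ℕ}
    (hx : x ^ N = 0) :
    NormedSpace.exp x = ∑ n ∈ Finset.range N, ((n.factorial : ℂ)⁻¹) • x ^ n := by
  rw [NormedSpace.exp_eq_tsum ℂ]
  refine tsum_eq_sum fun n hn => ?_
  rw [pow_eq_zero_of_le (by simpa using hn) hx, smul_zero]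

omit [FiniteDimensional ℂ E] in
/-- The derivative of `exp (-T (z - a))` for a linear map `T` with commuting values. -/
theorem hasFDerivAt_exp_comp {A : Type*} [NormedRing A] [NormedAlgebra ℂ A] [CompleteSpace A]
    (T : E →L[ℂ] A) (hT : ∀ u w, Commute (T u) (T w)) (a z : E) :
    HasFDerivAt (fun z' => NormedSpace.exp (-T (z' - a)))
      (-((ContinuousLinearMap.mul ℂ A).flip (NormedSpace.exp (-T (z - a)))).comp T) z := by
  let _ : NormedAlgebra ℚ A := NormedAlgebra.restrictScalars ℚ ℂ A
  have h1 : (fun z' => NormedSpace.exp (-T (z' - a))) = fun z' =>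
      (ContinuousLinearMap.mul ℂ A).flip (NormedSpace.exp (-T (z - a)))
        (NormedSpace.exp (-T (z' - z))) := by
    funext z'
    rw [ContinuousLinearMap.flip_apply, ContinuousLinearMap.mul_apply',
      ← NormedSpace.exp_add_of_commute ((hT _ _).neg_left.neg_right), ← neg_add, ← map_add,
      sub_add_sub_cancel]
  have h2 : HasFDerivAt (fun z' => -T (z' - z)) (-T) z :=
    (T.hasFDerivAt.comp z ((hasFDerivAt_id z).sub_const z)).neg
  have h3 : HasFDerivAt (fun z' => NormedSpace.exp (-T (z' - z)))
      ((1 : A →L[ℂ] A).comp (-T)) z := by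
    refine HasFDerivAt.comp z (g := NormedSpace.exp) ?_ h2
    rw [sub_self, map_zero, neg_zero]
    exact hasFDerivAt_exp_zero
  rw [h1]
  refine (((ContinuousLinearMap.mul ℂ A).flip
    (NormedSpace.exp (-T (z - a)))).hasFDerivAt.comp z h3).congr_fderiv ?_
  ext u
  simp

/-- If the derivatives of finitely many functions on a tube are linear combinations of the
functions themselves, with commuting coefficient matrices `T u`, then the functions are obtained
from their values at `a` through `exp (T (z - a))`: composing evaluation at `z` with
`exp (-T (z - a))` gives something with zero derivative along the tube. -/
theorem eventually_eq_exp_apply (hV : IsRealForm V) (hF : IsAnalyticSubmanifold F) {a : E}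
    (ha : a ∈ tube V F) {n : ℕ} (f : Fin n → E → E)
    (T : E →L[ℂ] ((Fin n → ℂ) →L[ℂ] (Fin n → ℂ))) (hT : ∀ u w, Commute (T u) (T w))
    (hf : ∀ᶠ z in 𝓝[tube V F] a, ∀ i, DifferentiableWithinAt ℂ (f i) (tube V F) z ∧
      ∀ u, fderivWithin ℂ (f i) (tube V F) z u = ∑ j, T u (Pi.single i 1) j • f j z) :
    ∀ᶠ z in 𝓝[tube V F] a, ∀ x : Fin n → ℂ,
      ∑ i, x i • f i z = ∑ i, NormedSpace.exp (T (z - a)) x i • f i a := by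
  let _ : NormedAlgebra ℚ ((Fin n → ℂ) →L[ℂ] (Fin n → ℂ)) := NormedAlgebra.restrictScalars ℚ ℂ _
  have hconst : ∀ k : Fin n, ∀ᶠ z in 𝓝[tube V F] a,
      ∑ i, NormedSpace.exp (-T (z - a)) (Pi.single k 1) i • f i z = f k a := by
    intro k
    have h0 := eventually_eq_of_hasFDerivWithinAt_zero hV hF ha
      (φ := fun z => ∑ i, NormedSpace.exp (-T (z - a)) (Pi.single k 1) i • f i z) ?_
    · filter_upwards [h0] with z hz
      rw [hz, sub_self, map_zero, neg_zero, NormedSpace.exp_zero]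
      simp [Pi.single_apply]
    · filter_upwards [hf] with z hz
      have hd : HasFDerivWithinAt
          (fun z => ∑ i, NormedSpace.exp (-T (z - a)) (Pi.single k 1) i • f i z) _ (tube V F) z :=
        HasFDerivWithinAt.fun_sum fun i _ =>
          (((ContinuousLinearMap.proj (R := ℂ) (φ := fun _ : Fin n => ℂ) i).comp
            (ContinuousLinearMap.apply ℂ (Fin n → ℂ) (Pi.single k (1 : ℂ)))).hasFDerivAt.comp z
              (hasFDerivAt_exp_comp T hT a z)).hasFDerivWithinAt.smul
            (hz i).1.hasFDerivWithinAt
      have hd' := hd.restrictScalars ℝ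
      refine hd'.congr_fderiv ?_
      ext u
      set x := NormedSpace.exp (-T (z - a)) (Pi.single k 1) with hx
      have key : ∑ i, x i • ∑ j, T u (Pi.single i 1) j • f j z = ∑ j, T u x j • f j z := by
        conv_rhs => rw [pi_eq_sum_univ' x]
        simp only [map_sum, map_smul, Finset.sum_apply, Pi.smul_apply, smul_eq_mul, Finset.sum_smul,
          mul_smul, Finset.smul_sum]
        exact Finset.sum_comm
      simp only [ContinuousLinearMap.coe_restrictScalars', sum_apply, add_apply,
        ContinuousLinearMap.smulRight_apply, smul_apply, ContinuousLinearMap.comp_apply, zero_apply]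
      change ∑ i, (x i • fderivWithin ℂ (f i) (tube V F) z u + (-(T u x)) i • f i z) = 0
      simp only [(hz _).2, Finset.sum_add_distrib, key, Pi.neg_apply, neg_smul,
        Finset.sum_neg_distrib, add_neg_cancel]
  have hconst' := eventually_all.2 hconst
  filter_upwards [hconst'] with z hz x
  have hlin : ∀ y : Fin n → ℂ,
      ∑ i, NormedSpace.exp (-T (z - a)) y i • f i z = ∑ i, y i • f i a := by
    intro y
    conv_lhs => rw [pi_eq_sum_univ' y]
    simp only [map_sum, map_smul, Finset.sum_apply, Pi.smul_apply, smul_eq_mul, Finset.sum_smul,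
      mul_smul]
    rw [Finset.sum_comm]
    simp only [← Finset.smul_sum]
    refine Finset.sum_congr rfl fun k _ => ?_
    rw [← hz k]
  have hinv : NormedSpace.exp (-T (z - a)) (NormedSpace.exp (T (z - a)) x) = x := by
    have h1 : NormedSpace.exp (-T (z - a)) * NormedSpace.exp (T (z - a)) = 1 := by
      rw [← NormedSpace.exp_add_of_commute (Commute.refl (T (z - a))).neg_left, neg_add_cancel,
        NormedSpace.exp_zero]
    exact congrArg (fun S : (Fin n → ℂ) →L[ℂ] (Fin n → ℂ) => S x) h1
  rw [← hlin, hinv]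

end Exponential

/-! ### Germs of CR fields -/

section Germs

variable {E : Type*} [NormedAddCommGroup E] [NormedSpace ℂ E]

/-- The germs at `a` of real-analytic CR functions on `M`. -/
def crGermSubmodule (M : Set E) (a : E) : Submodule ℂ (Germ (𝓝[M] a) E) where
  carrier := {ξ | ∃ f : E → E, (∀ᶠ z in 𝓝[M] a, IsCRFunctionAt M f z) ∧
    ξ = (f : Germ (𝓝[M] a) E)}
  zero_mem' := ⟨0, Eventually.of_forall fun _ => isCRFunctionAt_zero, rfl⟩
  add_mem' := by
    rintro _ _ ⟨f, hf, rfl⟩ ⟨g, hg, rfl⟩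
    exact ⟨f + g, by filter_upwards [hf, hg] with z h1 h2 using h1.add h2, rfl⟩
  smul_mem' := by
    rintro c _ ⟨f, hf, rfl⟩
    exact ⟨c • f, by filter_upwards [hf] with z h1 using h1.const_smul c, rfl⟩

/-- The germs at `a` of real-analytic vector fields tangent to `M` whose components are CR
functions. For tubes these are germs of infinitesimal CR-transformations, see
`crFieldGerms_subset_hol`; the converse inclusion, which needs local existence of
real-analytic flows, is not used. -/
def crFieldGerms (M : Set E) (a : E) : Set (Germ (𝓝[M] a) E) :=
  {ξ | ∃ f : E → E, (∀ᶠ z in 𝓝[M] a, IsCRFunctionAt M f z ∧ f z ∈ tangentVectors M z) ∧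
    ξ = (f : Germ (𝓝[M] a) E)}

theorem crFieldGerms_subset (M : Set E) (a : E) :
    crFieldGerms M a ⊆ (crGermSubmodule M a : Set (Germ (𝓝[M] a) E)) := by
  rintro _ ⟨f, hf, rfl⟩
  exact ⟨f, hf.mono fun _ h => h.1, rfl⟩

/-- The space of germs at `a` of real-analytic CR functions, as a type of its own, so that its
subspaces inherit their instances from a single additive group structure. -/
def CRGerm (M : Set E) (a : E) : Type _ := crGermSubmodule M a

noncomputable instance (M : Set E) (a : E) : AddCommGroup (CRGerm M a) :=
  inferInstanceAs (AddCommGroup (crGermSubmodule M a))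

noncomputable instance (M : Set E) (a : E) : Module ℂ (CRGerm M a) :=
  inferInstanceAs (Module ℂ (crGermSubmodule M a))

/-- The inclusion of germs of CR functions into all germs. -/
noncomputable def CRGerm.toGerm (M : Set E) (a : E) : CRGerm M a →ₗ[ℂ] Germ (𝓝[M] a) E :=
  (crGermSubmodule M a).subtype

theorem CRGerm.toGerm_injective (M : Set E) (a : E) :
    Function.Injective (CRGerm.toGerm M a) := Subtype.val_injective

/-- The complex derivative within `M` along the vector field `X`, on germs. It is linear only on
germs of differentiable functions. -/
noncomputable def germDeriv (M : Set E) (a : E) (X : E → E) :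
    Germ (𝓝[M] a) E → Germ (𝓝[M] a) E :=
  Germ.map' (fun f z => fderivWithin ℂ f M z (X z)) fun f g (h : f =ᶠ[𝓝[M] a] g) => by
    filter_upwards [h.fderivWithin (𝕜 := ℂ)] with z hz
    rw [hz]

/-- The derivative along `X` as an endomorphism of the space of germs of CR functions. -/
noncomputable def crGermDeriv (M : Set E) (a : E) (hM : UniqueDiffOn ℂ M) (X : E → E)
    (hX : ∀ f : E → E, (∀ᶠ z in 𝓝[M] a, IsCRFunctionAt M f z) →
      ∀ᶠ z in 𝓝[M] a, IsCRFunctionAt M (fun z => fderivWithin ℂ f M z (X z)) z) :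
    Module.End ℂ (CRGerm M a) where
  toFun ξ := ⟨germDeriv M a X ξ.1, by
    obtain ⟨_, f, hf, rfl⟩ := ξ
    exact ⟨_, hX f hf, rfl⟩⟩
  map_add' := by
    rintro ⟨_, f, hf, rfl⟩ ⟨_, g, hg, rfl⟩
    refine Subtype.ext (Germ.coe_eq.2 ?_)
    filter_upwards [hf, hg, self_mem_nhdsWithin] with z h1 h2 h3
    change fderivWithin ℂ (f + g) M z (X z) = _
    rw [fderivWithin_add (hM z h3) h1.2 h2.2]
    rfl
  map_smul' := by
    rintro c ⟨_, f, hf, rfl⟩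
    refine Subtype.ext (Germ.coe_eq.2 ?_)
    filter_upwards [hf, self_mem_nhdsWithin] with z h1 h3
    change fderivWithin ℂ (c • f) M z (X z) = _
    rw [fderivWithin_const_smul (hM z h3) h1.2 c]
    rfl

variable [FiniteDimensional ℂ E] {V : Submodule ℝ E} {F : Set V} {a : E}

theorem uniqueDiffOn_tube (hV : IsRealForm V) : UniqueDiffOn ℂ (tube V F) :=
  fun _ hz => uniqueDiffWithinAt_tube hV hz

theorem eventually_fderivWithin_apply (hV : IsRealForm V) (hF : IsAnalyticSubmanifold F)
    (u : E) (f : E → E) (hf : ∀ᶠ z in 𝓝[tube V F] a, IsCRFunctionAt (tube V F) f z) :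
    ∀ᶠ z in 𝓝[tube V F] a,
      IsCRFunctionAt (tube V F) (fun z => fderivWithin ℂ f (tube V F) z u) z := by
  filter_upwards [eventually_eventually_nhdsWithin.2 hf, self_mem_nhdsWithin] with z h1 h2
  exact (IsCRFunctionAt.fderivWithin_apply hV hF h2 h1).1 u

theorem eventually_fderivWithin_self (hV : IsRealForm V) (hF : IsAnalyticSubmanifold F)
    (f : E → E) (hf : ∀ᶠ z in 𝓝[tube V F] a, IsCRFunctionAt (tube V F) f z) :
    ∀ᶠ z in 𝓝[tube V F] a,
      IsCRFunctionAt (tube V F) (fun z => fderivWithin ℂ f (tube V F) z z) z := by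
  filter_upwards [eventually_eventually_nhdsWithin.2 hf, self_mem_nhdsWithin] with z h1 h2
  exact (IsCRFunctionAt.fderivWithin_self hV hF h2 h1).1

/-- The directional derivative `∂_u` on germs of CR functions, linear in `u`. -/
noncomputable def partialGerm (hV : IsRealForm V) (hF : IsAnalyticSubmanifold F) (a : E) :
    E →ₗ[ℂ] Module.End ℂ (CRGerm (tube V F) a) where
  toFun u := crGermDeriv (tube V F) a (uniqueDiffOn_tube hV) (fun _ => u)
    (eventually_fderivWithin_apply hV hF u)
  map_add' u w := by
    refine LinearMap.ext ?_
    rintro ⟨_, f, hf, rfl⟩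
    refine Subtype.ext (Germ.coe_eq.2 (Eventually.of_forall fun z => ?_))
    exact map_add _ _ _
  map_smul' c u := by
    refine LinearMap.ext ?_
    rintro ⟨_, f, hf, rfl⟩
    refine Subtype.ext (Germ.coe_eq.2 (Eventually.of_forall fun z => ?_))
    exact map_smul _ _ _

/-- The derivative `δ` along the Euler field on germs of CR functions. -/
noncomputable def eulerGerm (hV : IsRealForm V) (hF : IsAnalyticSubmanifold F) (a : E) :
    Module.End ℂ (CRGerm (tube V F) a) :=
  crGermDeriv (tube V F) a (uniqueDiffOn_tube hV) (fun z => z) (eventually_fderivWithin_self hV hF)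

theorem commute_partialGerm (hV : IsRealForm V) (hF : IsAnalyticSubmanifold F) (u w : E) :
    Commute (partialGerm hV hF a u) (partialGerm hV hF a w) := by
  refine LinearMap.ext ?_
  rintro ⟨_, f, hf, rfl⟩
  refine Subtype.ext (Germ.coe_eq.2 ?_)
  filter_upwards [eventually_eventually_nhdsWithin.2 hf, self_mem_nhdsWithin] with z h1 h2
  exact (IsCRFunctionAt.fderivWithin_apply hV hF h2 h1).2 w u

theorem partialGerm_mul_eulerGerm (hV : IsRealForm V) (hF : IsAnalyticSubmanifold F) (u : E) :
    partialGerm hV hF a u * eulerGerm hV hF a - eulerGerm hV hF a * partialGerm hV hF a u =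
      partialGerm hV hF a u := by
  rw [sub_eq_iff_eq_add']
  refine LinearMap.ext ?_
  rintro ⟨_, f, hf, rfl⟩
  refine Subtype.ext (Germ.coe_eq.2 ?_)
  filter_upwards [eventually_eventually_nhdsWithin.2 hf, self_mem_nhdsWithin] with z h1 h2
  exact (IsCRFunctionAt.fderivWithin_self hV hF h2 h1).2 u

theorem crFieldGerms_subset_hol (hV : IsRealForm V) (hF : IsAnalyticSubmanifold F) :
    crFieldGerms (tube V F) a ⊆ hol (tube V F) a := by
  rintro _ ⟨f, hf, rfl⟩
  obtain ⟨U, hU, haU, hsub⟩ := mem_nhdsWithin.1 hf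
  exact ⟨U, f, hU, haU, isInfinitesimalCR_of_isCRFunctionAt hV hF hU
    (fun z hz => (hsub ⟨hz.2, hz.1⟩).1) (fun z hz => (hsub ⟨hz.2, hz.1⟩).2), rfl⟩

/-- The complex span of the germs of CR fields. -/
noncomputable def crFieldSpan (M : Set E) (a : E) : Submodule ℂ (CRGerm M a) :=
  Submodule.span ℂ {ξ | ξ.1 ∈ crFieldGerms M a}

/-- A finite real spanning set of the germs of CR fields also spans their complex span. -/
theorem finiteDimensional_crFieldSpan (hV : IsRealForm V) (hF : IsAnalyticSubmanifold F)
    (hfin : HolFiniteDimensional (tube V F) a) :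
    FiniteDimensional ℂ (crFieldSpan (tube V F) a) := by
  have hst : IsScalarTower ℝ ℂ (Germ (𝓝[tube V F] a) E) :=
    ⟨fun r c ξ => Germ.inductionOn ξ fun f => congrArg _ (smul_assoc r c f)⟩
  have h1 : FiniteDimensional ℝ (Submodule.span ℝ (crFieldGerms (tube V F) a)) := by
    have : FiniteDimensional ℝ (Submodule.span ℝ (hol (tube V F) a)) := hfin
    exact Submodule.finiteDimensional_of_le (Submodule.span_mono (crFieldGerms_subset_hol hV hF))
  obtain ⟨t, ht⟩ := Module.Finite.iff_fg.1 h1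
  have h2 : Submodule.map (CRGerm.toGerm (tube V F) a) (crFieldSpan (tube V F) a) ≤
      Submodule.span ℂ (t : Set (Germ (𝓝[tube V F] a) E)) := by
    refine (Submodule.map_span_le _ _ _).2 fun ξ hξ => ?_
    have h3 : ξ.1 ∈ Submodule.span ℝ (t : Set (Germ (𝓝[tube V F] a) E)) := by
      rw [ht]
      exact Submodule.subset_span hξ
    exact Submodule.span_le_restrictScalars ℝ ℂ _ h3
  have h4 : FiniteDimensional ℂ (Submodule.span ℂ (t : Set (Germ (𝓝[tube V F] a) E))) :=
    FiniteDimensional.span_finset ℂ t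
  have h5 := Submodule.finiteDimensional_of_le h2
  exact LinearEquiv.finiteDimensional
    (Submodule.equivMapOfInjective _ (CRGerm.toGerm_injective _ _) _).symm

/-- `∂_{iv} f` is the bracket of the translation field `i v` with `f`. -/
theorem partialGerm_I_smul_mem (hV : IsRealForm V) (hF : IsAnalyticSubmanifold F) (v : V)
    {ξ : CRGerm (tube V F) a} (hξ : ξ.1 ∈ crFieldGerms (tube V F) a) :
    (partialGerm hV hF a (Complex.I • (v : E)) ξ).1 ∈ crFieldGerms (tube V F) a := by
  obtain ⟨_, hξ'⟩ := ξ
  obtain ⟨f, hf, rfl⟩ := hξ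
  have hcr := hf.mono fun _ h => h.1
  refine ⟨fun z => fderivWithin ℂ f (tube V F) z (Complex.I • (v : E)), ?_, rfl⟩
  filter_upwards [eventually_fderivWithin_apply hV hF (Complex.I • (v : E)) f hcr,
    eventually_eventually_nhdsWithin.2 hf, self_mem_nhdsWithin] with z h1 h2 h3
  refine ⟨h1, ?_⟩
  have h4 := bracket_mem_tangentVectors hV hF h3 (f := fun _ => Complex.I • (v : E)) (g := f)
    (differentiableWithinAt_const _) (h2.self_of_nhdsWithin h3).1.2
    (eventually_mem_nhdsWithin.mono fun z' hz' => I_smul_mem_tangentVectors hV hz' v)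
    (h2.mono fun _ h => h.2)
  simpa using h4

/-- `δ f - f` is the bracket of the Euler field with `f`; the Euler field is tangent by conicality. -/
theorem eulerGerm_sub_mem (hV : IsRealForm V) (hF : IsAnalyticSubmanifold F) (hFc : IsConical F)
    {ξ : CRGerm (tube V F) a} (hξ : ξ.1 ∈ crFieldGerms (tube V F) a) :
    (eulerGerm hV hF a ξ - ξ).1 ∈ crFieldGerms (tube V F) a := by
  obtain ⟨_, hξ'⟩ := ξ
  obtain ⟨f, hf, rfl⟩ := hξ
  have hcr := hf.mono fun _ h => h.1
  refine ⟨(fun z => fderivWithin ℂ f (tube V F) z z) + (-1 : ℂ) • f, ?_, ?_⟩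
  · filter_upwards [eventually_fderivWithin_self hV hF f hcr,
      eventually_eventually_nhdsWithin.2 hf, self_mem_nhdsWithin] with z h1 h2 h3
    have h5 := h2.self_of_nhdsWithin h3
    refine ⟨h1.add (h5.1.const_smul _), ?_⟩
    have h4 := bracket_mem_tangentVectors hV hF h3 (f := fun z => z) (g := f)
      differentiableWithinAt_id h5.1.2
      (eventually_mem_nhdsWithin.mono fun z' hz' => self_mem_tangentVectors hV hFc hz')
      (h2.mono fun _ h => h.2)
    rw [fderivWithin_fun_id (uniqueDiffWithinAt_tube hV h3)] at h4
    simpa [sub_eq_add_neg] using h4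
  · rw [neg_one_smul, ← sub_eq_add_neg]
    rfl

theorem partialGerm_mapsTo (hV : IsRealForm V) (hF : IsAnalyticSubmanifold F) (u : E) :
    ∀ ξ ∈ crFieldSpan (tube V F) a, partialGerm hV hF a u ξ ∈ crFieldSpan (tube V F) a := by
  intro ξ hξ
  have hI : ∀ v : V, partialGerm hV hF a (Complex.I • (v : E)) ξ ∈ crFieldSpan (tube V F) a := by
    intro v
    refine Submodule.span_induction (p := fun ξ _ => partialGerm hV hF a (Complex.I • (v : E)) ξ ∈
      crFieldSpan (tube V F) a) ?_ ?_ ?_ ?_ hξ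
    · exact fun ξ hξ => Submodule.subset_span (partialGerm_I_smul_mem hV hF v hξ)
    · simp
    · intro x y _ _ hx hy
      rw [map_add]
      exact Submodule.add_mem _ hx hy
    · intro c x _ hx
      rw [map_smul]
      exact Submodule.smul_mem _ c hx
  -- Every `u ∈ E` is a complex combination of two vectors in `iV`.
  have hu : u = Complex.I • (hV.im u : E) - Complex.I • Complex.I • (hV.re u : E) := by
    rw [I_smul_I_smul, sub_neg_eq_add, add_comm, hV.re_add_im]
  rw [hu, map_sub, map_smul _ Complex.I (Complex.I • (hV.re u : E))]
  exact Submodule.sub_mem _ (hI _) (Submodule.smul_mem _ _ (hI _))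

theorem eulerGerm_mapsTo (hV : IsRealForm V) (hF : IsAnalyticSubmanifold F) (hFc : IsConical F) :
    ∀ ξ ∈ crFieldSpan (tube V F) a, eulerGerm hV hF a ξ ∈ crFieldSpan (tube V F) a := by
  intro ξ hξ
  refine Submodule.span_induction (p := fun ξ _ => eulerGerm hV hF a ξ ∈
      crFieldSpan (tube V F) a) ?_ ?_ ?_ ?_ hξ
  · intro ξ hξ
    have h1 : eulerGerm hV hF a ξ - ξ ∈ crFieldSpan (tube V F) a :=
      Submodule.subset_span (eulerGerm_sub_mem hV hF hFc hξ)
    simpa using Submodule.add_mem _ h1 (Submodule.subset_span hξ)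
  · simp
  · intro x y _ _ hx hy
    rw [map_add]
    exact Submodule.add_mem _ hx hy
  · intro c x _ hx
    rw [map_smul]
    exact Submodule.smul_mem _ c hx

/-- The directional derivative `∂_u` on the complex span of the germs of CR fields. -/
noncomputable def partialSpan (hV : IsRealForm V) (hF : IsAnalyticSubmanifold F) (a : E) :
    E →ₗ[ℂ] Module.End ℂ (crFieldSpan (tube V F) a) where
  toFun u := (partialGerm hV hF a u).restrict (partialGerm_mapsTo hV hF u)
  map_add' u w := LinearMap.ext fun ξ => Subtype.ext (by simp)
  map_smul' c u := LinearMap.ext fun ξ => Subtype.ext (by simp)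

theorem commute_partialSpan (hV : IsRealForm V) (hF : IsAnalyticSubmanifold F) (u w : E) :
    Commute (partialSpan hV hF a u) (partialSpan hV hF a w) :=
  LinearMap.ext fun ξ => Subtype.ext
    (LinearMap.congr_fun (commute_partialGerm (a := a) hV hF u w).eq ξ.1)

theorem isNilpotent_partialSpan (hV : IsRealForm V) (hF : IsAnalyticSubmanifold F)
    (hFc : IsConical F) (hfin : HolFiniteDimensional (tube V F) a) (u : E) :
    IsNilpotent (partialSpan hV hF a u) := by
  have := finiteDimensional_crFieldSpan hV hF hfin
  refine isNilpotent_of_commutator_eq_self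
    (δ := (eulerGerm hV hF a).restrict (eulerGerm_mapsTo hV hF hFc)) ?_
  exact LinearMap.ext fun ξ => Subtype.ext
    (LinearMap.congr_fun (partialGerm_mul_eulerGerm (a := a) hV hF u) ξ.1)

/-- Every germ of a CR field is polynomial when `hol(M, a)` has finite dimension and the base of the
tube is conical. -/
theorem exists_cpolynomialOn_eventually_eq (hV : IsRealForm V) (hF : IsAnalyticSubmanifold F)
    (hFc : IsConical F) (ha : a ∈ tube V F) (hfin : HolFiniteDimensional (tube V F) a) {f : E → E}
    (hf : ∀ᶠ z in 𝓝[tube V F] a,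
      IsCRFunctionAt (tube V F) f z ∧ f z ∈ tangentVectors (tube V F) z) :
    ∃ P : E → E, CPolynomialOn ℂ P univ ∧ ∀ᶠ z in 𝓝[tube V F] a, f z = P z := by
  have := finiteDimensional_crFieldSpan hV hF hfin
  let W := crFieldSpan (tube V F) a
  let n := Module.finrank ℂ W
  let β : Module.Basis (Fin n) ℂ W := Module.finBasis ℂ W
  choose g hg hgβ using fun i => (β i).1.2
  let Θ : Module.End ℂ W ≃ₐ[ℂ] ((Fin n → ℂ) →L[ℂ] (Fin n → ℂ)) :=
    (β.equivFun.conjAlgEquiv ℂ).trans (Module.End.toContinuousLinearMap _)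
  let T : E →L[ℂ] ((Fin n → ℂ) →L[ℂ] (Fin n → ℂ)) :=
    LinearMap.toContinuousLinearMap (Θ.toLinearMap ∘ₗ partialSpan hV hF a)
  have hTΘ : ∀ u, T u = Θ (partialSpan hV hF a u) := fun u => rfl
  have hTcomm : ∀ u w, Commute (T u) (T w) := fun u w =>
    (commute_partialSpan hV hF u w).map Θ
  have hTapply : ∀ u x, T u x = β.equivFun (partialSpan hV hF a u (β.equivFun.symm x)) :=
    fun u x => rfl
  have hTnil : ∀ u, T u ^ n = 0 := by
    intro u
    obtain ⟨k, hk⟩ := isNilpotent_partialSpan hV hF hFc hfin u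
    have h1 : partialSpan hV hF a u ^ n = 0 := by
      have h2 := (Module.End.ker_pow_le_ker_pow_finrank (partialSpan hV hF a u) k)
      rw [hk] at h2
      exact LinearMap.ker_eq_top.1 (top_le_iff.1 (by simpa using h2))
    rw [hTΘ, ← map_pow, h1, map_zero]
  have hgerm : ∀ x : Fin n → ℂ, (CRGerm.toGerm (tube V F) a (β.equivFun.symm x).1 : Germ (𝓝[tube V F] a) E) =
      ((fun z => ∑ i, x i • g i z : E → E) : Germ (𝓝[tube V F] a) E) := by
    intro x
    have h1 : ∀ i, CRGerm.toGerm (tube V F) a (β i).1 = (g i : Germ (𝓝[tube V F] a) E) := hgβ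
    have h2 : (fun z => ∑ i, x i • g i z) = ∑ i, x i • g i := by
      ext z
      simp
    rw [Module.Basis.equivFun_symm_apply, AddSubmonoidClass.coe_finsetSum, map_sum, h2]
    change _ = Germ.coeAddHom (𝓝[tube V F] a) (∑ i, x i • g i)
    rw [map_sum]
    refine Finset.sum_congr rfl fun i _ => ?_
    rw [Submodule.coe_smul, map_smul, h1]
    rfl
  have hder : ∀ u, ∀ i, ∀ᶠ z in 𝓝[tube V F] a,
      fderivWithin ℂ (g i) (tube V F) z u = ∑ j, T u (Pi.single i 1) j • g j z := by
    intro u i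
    refine Germ.coe_eq.1 ?_
    rw [← hgerm, hTapply, LinearEquiv.symm_apply_apply]
    have h1 : β.equivFun.symm (Pi.single i 1) = β i := by simp [Module.Basis.equivFun_symm_apply]
    rw [h1]
    change _ = germDeriv (tube V F) a (fun _ => u) (β i).1.1
    rw [hgβ i]
    rfl
  let b := Module.finBasis ℂ E
  have hder' : ∀ᶠ z in 𝓝[tube V F] a, ∀ i k,
      fderivWithin ℂ (g i) (tube V F) z (b k) = ∑ j, T (b k) (Pi.single i 1) j • g j z :=
    eventually_all.2 fun i => eventually_all.2 fun k => hder (b k) i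
  have hgood : ∀ᶠ z in 𝓝[tube V F] a, ∀ i, DifferentiableWithinAt ℂ (g i) (tube V F) z ∧
      ∀ u, fderivWithin ℂ (g i) (tube V F) z u = ∑ j, T u (Pi.single i 1) j • g j z := by
    filter_upwards [hder', eventually_all.2 hg] with z h1 h2 i
    refine ⟨(h2 i).2, fun u => ?_⟩
    conv_lhs => rw [← b.sum_repr u, map_sum]
    conv_rhs => rw [← b.sum_repr u, map_sum]
    simp only [map_smul, h1, sum_apply, smul_apply, Finset.sum_apply, Pi.smul_apply, smul_eq_mul,
      Finset.sum_smul, mul_smul, Finset.smul_sum]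
    exact Finset.sum_comm
  have hmain := eventually_eq_exp_apply hV hF ha g T hTcomm hgood
  have hfW : (⟨(f : Germ (𝓝[tube V F] a) E),
      crFieldGerms_subset _ _ ⟨f, hf, rfl⟩⟩ : CRGerm (tube V F) a) ∈ W :=
    Submodule.subset_span ⟨f, hf, rfl⟩
  let x := β.equivFun ⟨_, hfW⟩
  have hfx : f =ᶠ[𝓝[tube V F] a] fun z => ∑ i, x i • g i z := by
    refine Germ.coe_eq.1 ?_
    rw [← hgerm, LinearEquiv.symm_apply_apply]
    rfl
  refine ⟨fun z => ∑ i, (∑ k ∈ Finset.range n, ((k.factorial : ℂ)⁻¹) • T (z - a) ^ k) x i • g i a,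
    fun z _ => ?_, ?_⟩
  · let ev : ((Fin n → ℂ) →L[ℂ] (Fin n → ℂ)) →L[ℂ] E :=
      (LinearMap.toContinuousLinearMap (Fintype.linearCombination ℂ (fun i => g i a))).comp
        (ContinuousLinearMap.apply ℂ (Fin n → ℂ) x)
    refine CPolynomialAt.clm_comp (f := fun z => ∑ k ∈ Finset.range n,
      ((k.factorial : ℂ)⁻¹) • T (z - a) ^ k) ev (CPolynomialAt.sum _ fun k _ => ?_)
    refine CPolynomialAt.clm_comp (((k.factorial : ℂ)⁻¹) •
      ContinuousLinearMap.id ℂ ((Fin n → ℂ) →L[ℂ] (Fin n → ℂ))) ?_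
    refine CPolynomialAt.pow (CPolynomialAt.clm_comp T ?_) k
    exact ((ContinuousLinearMap.id ℂ E).cpolynomialAt z).sub CPolynomialAt_const
  · filter_upwards [hfx, hmain] with z h1 h2
    rw [h1, h2 x, exp_eq_sum_of_pow_eq_zero (hTnil _)]

end Germs

/-! ### Pullback of fields and rationality -/

section Rational

variable {E : Type*} [NormedAddCommGroup E] [NormedSpace ℂ E]

theorem _root_.AnalyticOn.analyticWithinAt_of_inter {M U : Set E} (hU : IsOpen U) {f : E → E}
    (hf : AnalyticOn ℝ f (M ∩ U)) {z : E} (hz : z ∈ M ∩ U) : AnalyticWithinAt ℝ f M z :=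
  (hf z hz).mono_of_mem_nhdsWithin (inter_mem self_mem_nhdsWithin
    (mem_nhdsWithin_of_mem_nhds (hU.mem_nhds hz.2)))

theorem IsCRFunctionAt.comp {M M' U : Set E} (hU : IsOpen U) {g h : E → E} {z : E} (hz : z ∈ U)
    (hMM' : MapsTo h (M ∩ U) M')
    (hg : IsCRFunctionAt M' g (h z)) (hh : IsCRFunctionAt M h z) :
    IsCRFunctionAt M (fun z => g (h z)) z := by
  have hmem : M ∩ U ∈ 𝓝[M] z := inter_mem self_mem_nhdsWithin
    (mem_nhdsWithin_of_mem_nhds (hU.mem_nhds hz))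
  constructor
  · exact (hg.1.comp (f := h) (hh.1.mono inter_subset_left) hMM').mono_of_mem_nhdsWithin hmem
  · exact (hg.2.comp z (hh.2.mono inter_subset_left) hMM').mono_of_mem_nhdsWithin hmem

theorem fderivWithin_mem_tangentVectors {M M' U' : Set E} (hU' : IsOpen U') {k : E → E} {w : E}
    (hw : w ∈ U') (hk : MapsTo k (M' ∩ U') M) (hkd : DifferentiableWithinAt ℂ k M' w)
    {u : E} (hu : u ∈ tangentVectors M' w) :
    fderivWithin ℂ k M' w u ∈ tangentVectors M (k w) := by
  obtain ⟨γ, h0, hγ, hd⟩ := hu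
  refine ⟨fun t => k (γ t), by simp [h0], ?_, hasDerivAt_of_hasFDerivWithinAt
    (hkd.hasFDerivWithinAt.restrictScalars ℝ) h0 hγ hd⟩
  have hγU : ∀ᶠ t in 𝓝 (0 : ℝ), γ t ∈ U' :=
    hd.continuousAt.eventually (by rw [h0]; exact hU'.mem_nhds hw)
  filter_upwards [hγ, hγU] with t h1 h2 using hk ⟨h1, h2⟩

variable [FiniteDimensional ℂ E]

/-- Cramer's rule: if `C(z)` is linear, invertible at `a`, with `C(z) u` and `C(z) (h z)` polynomial in
`z`, then `h` is rational with denominator `det C(z)`. -/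
theorem isRationalGerm_of_cpolynomialOn {M : Set E} {a : E} (ha : a ∈ M) {h : E → E}
    {C : E → E →L[ℂ] E} (hC : ∀ u, ∃ P : E → E, CPolynomialOn ℂ P univ ∧
      ∀ᶠ z in 𝓝[M] a, C z u = P z)
    (hCh : ∃ P : E → E, CPolynomialOn ℂ P univ ∧ ∀ᶠ z in 𝓝[M] a, C z (h z) = P z)
    (hinj : Function.Injective (C a)) : IsRationalGerm M a h := by
  have : CompleteSpace E := FiniteDimensional.complete ℂ E
  choose P hP hPC using hC
  obtain ⟨R, hR, hRC⟩ := hCh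
  let b := Module.finBasis ℂ E
  let coord : ∀ i, E →L[ℂ] ℂ := fun i => LinearMap.toContinuousLinearMap (b.coord i)
  let A : E → Matrix _ _ ℂ := fun z => Matrix.of fun i j => coord i (P (b j) z)
  let r : E → _ → ℂ := fun z i => coord i (R z)
  have hA : ∀ z i j, CPolynomialAt ℂ (fun z => A z i j) z := fun z i j =>
    CPolynomialAt.clm_comp (coord i) (hP (b j) z (mem_univ _))
  have hr : ∀ z i, CPolynomialAt ℂ (fun z => r z i) z := fun z i =>
    CPolynomialAt.clm_comp (coord i) (hR z (mem_univ _))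
  have hdet : CPolynomialOn ℂ (fun z => (A z).det) univ := fun z _ => CPolynomialAt.det (hA z)
  have hcramer : CPolynomialOn ℂ (fun z => ∑ i, (A z).cramer (r z) i • b i) univ := by
    intro z _
    refine CPolynomialAt.sum _ fun i _ => CPolynomialAt.clm_comp
      (f := fun z => (A z).cramer (r z) i) ((ContinuousLinearMap.id ℂ ℂ).smulRight (b i)) ?_
    simp only [Matrix.cramer_apply]
    refine CPolynomialAt.det fun i' j' => ?_
    by_cases hj : j' = i
    · subst hj
      simpa using hr z i'
    · simpa [Matrix.updateCol_ne hj] using hA z i' j'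
  have hAC : ∀ᶠ z in 𝓝[M] a, A z = LinearMap.toMatrix b b (C z : E →ₗ[ℂ] E) := by
    filter_upwards [eventually_all.2 fun j => hPC (b j)] with z hz
    ext i j
    simp [A, coord, LinearMap.toMatrix_apply, hz]
  have hdeta : (A a).det ≠ 0 := by
    rw [hAC.self_of_nhdsWithin ha, LinearMap.det_toMatrix]
    exact (LinearEquiv.ofInjectiveEndo (C a : E →ₗ[ℂ] E) hinj).isUnit_det'.ne_zero
  refine ⟨_, _, isPolynomialMap_of_cpolynomialOn hcramer, isPolynomialMap_of_cpolynomialOn hdet,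
    hdeta, ?_⟩
  have hne : ∀ᶠ z in 𝓝[M] a, (A z).det ≠ 0 :=
    nhdsWithin_le_nhds (hdet.continuous.continuousAt.eventually_ne hdeta)
  filter_upwards [hAC, hRC, hne] with z h1 h2 h3
  have h4 : r z = (A z).mulVec (b.repr (h z)) := by
    rw [h1, LinearMap.toMatrix_mulVec_repr]
    ext i
    simp [r, coord, ← h2]
  rw [h4, Matrix.cramer_eq_adjugate_mulVec, Matrix.mulVec_mulVec, Matrix.adjugate_mul,
    Matrix.smul_mulVec, Matrix.one_mulVec]
  simp only [Pi.smul_apply, smul_eq_mul, mul_smul, ← Finset.smul_sum]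
  rw [smul_smul, inv_mul_cancel₀ h3, one_smul, b.sum_repr]

end Rational

end CRTube

theorem proposition4p3 {E : Type*} [NormedAddCommGroup E] [NormedSpace ℂ E]
    [FiniteDimensional ℂ E] (V : Submodule ℝ E) (hV : CRTube.IsRealForm V)
    (F F' : Set V)
    (hF : CRTube.IsAnalyticSubmanifold F) (hFc : CRTube.IsConical F)
    (hF' : CRTube.IsAnalyticSubmanifold F') (hFc' : CRTube.IsConical F')
    (a a' : V) (ha : a ∈ F) (ha' : a' ∈ F')
    (hfin : CRTube.HolFiniteDimensional (CRTube.tube V F) (a : E))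
    (h : E → E)
    (hh : CRTube.IsCRIsoGerm (CRTube.tube V F) (a : E) (CRTube.tube V F') (a' : E) h) :
    CRTube.IsRationalGerm (CRTube.tube V F) (a : E) h := by
  open CRTube in
  obtain ⟨hha, U, U', k, hU, hU', haU, haU', hmaps, kmaps, hinv, han, kan, hCR, kCR⟩ := hh
  have haM : (a : E) ∈ tube V F := (mem_tube_iff hV).2 (by simpa using ha)
  have haM' : (a' : E) ∈ tube V F' := (mem_tube_iff hV).2 (by simpa using ha')
  have hcr : ∀ z ∈ tube V F ∩ U, IsCRFunctionAt (tube V F) h z := fun z hz =>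
    (hCR z hz).isCRFunctionAt hV hF hz.1 (han.analyticWithinAt_of_inter hU hz)
  have kcr : ∀ w ∈ tube V F' ∩ U', IsCRFunctionAt (tube V F') k w := fun w hw =>
    (kCR w hw).isCRFunctionAt hV hF' hw.1 (kan.analyticWithinAt_of_inter hU' hw)
  have kcr' : ∀ w ∈ tube V F' ∩ U', ∀ᶠ w' in 𝓝[tube V F'] w, IsCRFunctionAt (tube V F') k w' := by
    intro w hw
    filter_upwards [self_mem_nhdsWithin, mem_nhdsWithin_of_mem_nhds (hU'.mem_nhds hw.2)]
      with w' h1 h2 using kcr w' ⟨h1, h2⟩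
  have hUev : ∀ᶠ z in 𝓝[tube V F] (a : E), z ∈ tube V F ∩ U :=
    inter_mem self_mem_nhdsWithin (mem_nhdsWithin_of_mem_nhds (hU.mem_nhds haU))
  have hmaps' : MapsTo h (tube V F ∩ U) (tube V F') := fun z hz => (hmaps hz).1
  have kmaps' : MapsTo k (tube V F' ∩ U') (tube V F) := fun z hz => (kmaps hz).1
  have htan : ∀ z ∈ tube V F ∩ U, ∀ u ∈ tangentVectors (tube V F') (h z),
      fderivWithin ℂ k (tube V F') (h z) u ∈ tangentVectors (tube V F) z := by
    intro z hz u hu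
    have := fderivWithin_mem_tangentVectors hU' (hmaps hz).2 kmaps' (kcr _ (hmaps hz)).2 hu
    rwa [hinv.1 hz] at this
  have hpoly : ∀ v : V, ∃ P : E → E, CPolynomialOn ℂ P univ ∧ ∀ᶠ z in 𝓝[tube V F] (a : E),
      fderivWithin ℂ k (tube V F') (h z) (Complex.I • (v : E)) = P z := by
    intro v
    refine exists_cpolynomialOn_eventually_eq hV hF hFc haM hfin ?_
    filter_upwards [hUev] with z hz
    refine ⟨?_, htan z hz _ (I_smul_mem_tangentVectors hV (hmaps hz).1 v)⟩
    exact IsCRFunctionAt.comp hU hz.2 hmaps' ((IsCRFunctionAt.fderivWithin_apply hV hF'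
      (hmaps hz).1 (kcr' _ (hmaps hz))).1 _) (hcr z hz)
  have heuler : ∃ P : E → E, CPolynomialOn ℂ P univ ∧ ∀ᶠ z in 𝓝[tube V F] (a : E),
      fderivWithin ℂ k (tube V F') (h z) (h z) = P z := by
    refine exists_cpolynomialOn_eventually_eq hV hF hFc haM hfin ?_
    filter_upwards [hUev] with z hz
    refine ⟨?_, htan z hz _ (self_mem_tangentVectors hV hFc' (hmaps hz).1)⟩
    exact IsCRFunctionAt.comp hU hz.2 hmaps' ((IsCRFunctionAt.fderivWithin_self hV hF'
      (hmaps hz).1 (kcr' _ (hmaps hz))).1) (hcr z hz)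
  refine isRationalGerm_of_cpolynomialOn haM (C := fun z => fderivWithin ℂ k (tube V F') (h z))
    (fun u => ?_) heuler ?_
  · obtain ⟨P, hP, hPk⟩ := hpoly (hV.im u)
    obtain ⟨Q, hQ, hQk⟩ := hpoly (hV.re u)
    -- Here `u = i Im u - i (i Re u)`, and `C(z)` is complex linear.
    refine ⟨fun z => P z - Complex.I • Q z, fun z hz => (hP z hz).sub
      (CPolynomialAt.clm_comp (Complex.I • ContinuousLinearMap.id ℂ E) (hQ z hz)), ?_⟩
    filter_upwards [hPk, hQk] with z h1 h2
    rw [← h1, ← h2, ← map_smul, ← map_sub, I_smul_I_smul, sub_neg_eq_add, add_comm,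
      hV.re_add_im]
  · have hm := hmaps ⟨haM, haU⟩
    have hm' : tube V F' ∩ U' ∈ 𝓝[tube V F'] (h a) :=
      inter_mem self_mem_nhdsWithin (mem_nhdsWithin_of_mem_nhds (hU'.mem_nhds hm.2))
    have hk := (kcr _ hm).2.hasFDerivWithinAt
    have hd := (hcr _ ⟨haM, haU⟩).2.hasFDerivWithinAt
    have hd' : HasFDerivWithinAt h (fderivWithin ℂ h (tube V F) a) (tube V F) (k (h a)) := by
      rwa [hinv.1 ⟨haM, haU⟩]
    have hcomp : HasFDerivWithinAt (fun w => h (k w)) _ (tube V F' ∩ U') (h a) :=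
      hd'.comp (h a) (hk.mono inter_subset_left) kmaps'
    have hid : HasFDerivWithinAt (fun w => h (k w)) (ContinuousLinearMap.id ℂ E)
        (tube V F' ∩ U') (h a) :=
      (hasFDerivWithinAt_id (h a) _).congr (fun w hw => hinv.2 hw) (hinv.2 hm)
    have heq := (uniqueDiffWithinAt_tube hV hm.1).eq (hcomp.mono_of_mem_nhdsWithin hm')
      (hid.mono_of_mem_nhdsWithin hm')
    exact Function.LeftInverse.injective (g := fderivWithin ℂ h (tube V F) a) fun u =>
      congrArg (fun L : E →L[ℂ] E => L u) heq
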